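/- Consider the continuous-time totally asymmetric simple exclusion process (TASEP) on $\mathbb{Z}$: at most one particle per site, and each particle jumps to its right neighbour site at rate $1$ provided that site is empty. Label the particles $1,2,3,\ldots$ from right to left, let $x_1^n(t)\in\mathbb{Z}$ be the position at time $t\ge 0$ of the particle with label $n\ge 1$, and start from the step initial condition $x_1^n(0)=-n$ for all $n\geq 1$. For pairs in $\{1,2,\ldots\}\times[0,\infty)$ write $$(n,t)\prec(n',t')\iff n\ge n',\ t\le t'\text{ and }(n,t)\ne(n',t').$$ Let $(n_1,t_1)\prec(n_2,t_2)\prec\cdots\prec(n_m,t_m)$ and $s_1,\ldots,s_m\in\mathbb{R}$. Then $$\mathbb{P}\Big(\bigcap_{k=1}^m\{x_1^{n_k}(t_k)\ge s_k\}\Big)=\det(1-P_sKP_s)_{\ell^2(\{(n_1,t_1),\ldots,(n_m,t_m)\}\times\mathbb{Z})},$$ where $P_s$ is the multiplication by $P_s((n_k,t_k),x)=\mathbf 1_{[x<s_k]}$ and the Fredholm determinant is understood through its Fredholm series, that is, it equals $$\sum_{N\ge 0}\frac{(-1)^N}{N!}\sum_{\ell_1=1}^m\cdots\sum_{\ell_N=1}^m\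 \sum_{x_1<s_{\ell_1}}\cdots\sum_{x_N<s_{\ell_N}}\det\big(K(n_{\ell_i},t_{\ell_i},x_i;n_{\ell_j},t_{\ell_j},x_j)\big)_{i,j=1}^N ,$$ with all sums absolutely convergent. The kernel is $$\begin{aligned}K(n,t,x;n',t',x')=&-\mathbf 1_{[(n',t')\prec(n,t)]}\frac{1}{2\pi i}\oint_{\Gamma_0}dw\,\frac{1}{w^{x-x'+1}}\Big(\frac{w}{1-w}\Big)^{n'-n}e^{(t-t')w}\\&+\frac{1}{(2\pi i)^2}\oint_{\Gamma_1}dz\oint_{\Gamma_0}dw\,\frac{e^{tw}(1-w)^{n}}{w^{x+n+1}}\,\frac{z^{x'+n'}}{e^{t'z}(1-z)^{n'}}\,\frac{1}{w-z},\end{aligned}$$ where $\Gamma_0=\{|w|=r\}$ and $\Gamma_1=\{|z-1|=R\}$ are anticlockwise circles with arbitrary $r,R>0$, $r+R<1$. -/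

import Mathlib

open MeasureTheory
open scoped NNReal

/-! ### The totally asymmetric simple exclusion process, with labelled particles

A configuration is a function `x : ℕ+ → ℤ`; `x n` is the position of the particle with label `n`.
Particles are labelled from right to left, so the configurations of the process are strictly
decreasing functions. -/

/-- The backward generator of TASEP:
`(L f)(x) = ∑ₙ 1[site x n + 1 is empty] (f (x with particle n moved one step to the right) - f x)`.
It is applied to functions `f` that depend on finitely many particles; for such `f` and strictly
decreasing `x` only finitely many terms of the sum are nonzero. -/
noncomputable def tasepGenerator (f : (ℕ+ → ℤ) → ℝ) (x : ℕ+ → ℤ) : ℝ :=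
  open Classical in
  ∑' n : ℕ+, if ∀ j, x j ≠ x n + 1 then f (Function.update x n (x n + 1)) - f x else 0

/-- The transition semigroup `e^{tL} f = ∑ₖ (tᵏ / k!) Lᵏ f` of TASEP, for bounded functions `f` that
depend on finitely many particles. (If `f` depends on the first `N` particles only, then so does
`L f` on strictly decreasing configurations, and `|L f| ≤ 2 N sup |f|` there, so that the series
converges absolutely.) -/
noncomputable def tasepSemigroup (t : ℝ≥0) (f : (ℕ+ → ℤ) → ℝ) (x : ℕ+ → ℤ) : ℝ :=
  ∑' k : ℕ, ((t : ℝ) ^ k / (k.factorial : ℝ)) * (tasepGenerator^[k] f) x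

/-- The information carried by the process `X` up to time `s`. -/
def tasepPast {Ω : Type*} (X : ℝ≥0 → Ω → (ℕ+ → ℤ)) (s : ℝ≥0) : MeasurableSpace Ω :=
  ⨆ r : ℝ≥0, ⨆ _ : r ≤ s, MeasurableSpace.comap (X r) inferInstance

/-- `X` is a TASEP with step initial condition under the probability measure `μ`:
`X t ω n` is the position at time `t` of the particle with label `n`; at time `0` particle `n` is
at `-n`; and `X` is a Markov process, with values in the strictly decreasing configurations, whose
transition semigroup is `e^{tL}`. -/
structure IsStepTASEP {Ω : Type*} [MeasurableSpace Ω] (μ : Measure Ω)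
    (X : ℝ≥0 → Ω → (ℕ+ → ℤ)) : Prop where
  measurable : ∀ t, Measurable (X t)
  initial : ∀ᵐ ω ∂μ, ∀ n : ℕ+, X 0 ω n = -((n : ℕ) : ℤ)
  ordered : ∀ t, ∀ᵐ ω ∂μ, StrictAnti (X t ω)
  markov : ∀ (s t : ℝ≥0) (f : (ℕ+ → ℤ) → ℝ),
    (∃ S : Finset ℕ+, DependsOn f (S : Set ℕ+)) → (∃ C : ℝ, ∀ x, |f x| ≤ C) →
    μ[fun ω => f (X (s + t) ω) | tasepPast X s] =ᵐ[μ] fun ω => tasepSemigroup t f (X s ω)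

/-! ### Space-like order and kernel -/

/-- `(n₁, t₁) ≺ (n₂, t₂)`: `n₁ ≥ n₂`, `t₁ ≤ t₂` and the two pairs are different. -/
def SpaceLikePrec (a b : ℕ × ℝ) : Prop :=
  b.1 ≤ a.1 ∧ a.2 ≤ b.2 ∧ a ≠ b

/-- The correlation kernel `K(n₁, t₁, x₁; n₂, t₂, x₂)`. The contour around `0` is the
anticlockwise circle `|w| = r`, the one around `1` the anticlockwise circle `|z - 1| = R`; for
`0 < r`, `0 < R`, `r + R < 1` each of them encloses no other pole of the integrand. -/
noncomputable def tasepKernel (r R : ℝ) (n₁ : ℕ) (t₁ : ℝ) (x₁ : ℤ) (n₂ : ℕ) (t₂ : ℝ) (x₂ : ℤ) : ℂ :=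
  open Classical in
  -(if SpaceLikePrec (n₂, t₂) (n₁, t₁) then
      (2 * Real.pi * Complex.I)⁻¹ *
        ∮ w in C(0, r), (1 / w ^ (x₁ - x₂ + 1)) * (w / (1 - w)) ^ ((n₂ : ℤ) - (n₁ : ℤ)) *
          Complex.exp (((t₁ - t₂ : ℝ) : ℂ) * w)
    else 0) +
  ((2 * Real.pi * Complex.I) ^ 2)⁻¹ *
    ∮ z in C(1, R), ∮ w in C(0, r),
      (Complex.exp ((t₁ : ℂ) * w) * (1 - w) ^ n₁ / w ^ (x₁ + (n₁ : ℤ) + 1)) *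
      (z ^ (x₂ + (n₂ : ℤ)) / (Complex.exp ((t₂ : ℂ) * z) * (1 - z) ^ n₂)) *
      (1 / (w - z))

/-! ### Fredholm determinants on a discrete space -/

/-- `det(1 - K)` on `ℓ²(ι)` exists as a Fredholm series and equals `d`, i.e.
`d = ∑ₖ ((-1)ᵏ / k!) ∑_{y₁, …, yₖ ∈ ι} det (K (yᵢ, yⱼ))_{i,j ≤ k}`, where all sums converge
absolutely. -/
def HasFredholmDet {ι : Type*} (K : ι → ι → ℂ) (d : ℂ) : Prop :=
  (∀ k : ℕ, Summable fun y : Fin k → ι => (Matrix.of fun i j : Fin k => K (y i) (y j)).det) ∧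
  HasSum (fun k : ℕ => ((-1 : ℂ) ^ k / (k.factorial : ℂ)) *
    ∑' y : Fin k → ι, (Matrix.of fun i j : Fin k => K (y i) (y j)).det) d

/-- The kernel of `P_s K P_s` on `{(n₁, t₁), …, (nₘ, tₘ)} × ℤ`, where `(a, x)` stands for
`((n_a, t_a), x)` and `P_s` is the multiplication by `1[x < s_a]`. -/
noncomputable def cutKernel {m : ℕ} (s : Fin m → ℝ) (K : Fin m × ℤ → Fin m × ℤ → ℂ)
    (p q : Fin m × ℤ) : ℂ :=
  (if (p.2 : ℝ) < s p.1 then 1 else 0) * K p q * (if (q.2 : ℝ) < s q.1 then 1 else 0)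

/-! ### Contour integrals -/

/-! Write `u = x + n` for the position of particle `n` shifted by its label: it starts at `0` and is
almost surely never negative. Expanding `1 / (w - z)` geometrically turns the double contour
integral into a finite sum of products `kernelPsi * kernelPhi`. In shifted coordinates `1 - K` is
the identity, plus a `kernelPsi` term between ordered points, plus this finite-rank part. Since
`kernelPsi` vanishes for negative `u`, every minor of the cut kernel that uses a site outside the
finite windows `0 ≤ u < c` is zero. The Fredholm determinant is therefore an ordinary determinant
(`hasFredholmDet_cutKernel`).

That determinant is embedded in a larger family `chainDet`: the given points, regarded as past,
together with all labels `1, …, N` at a running time `T`, each point carrying a constraint `c`. The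
probability of the same constraints satisfies the same rules as this determinant:

Evolution: the generator applied to the indicator of weakly decreasing constraints lowers one
constraint at a time (`tasepGenerator_constraintInd`), and `hasDerivAt_chainDet` is the matching
equation for determinants. The system is triangular in the total constraint, so its solution is
unique (`eq_zero_of_hasDerivAt_lowering`).

Exclusion: a constraint implied by that of the next label is redundant
(`chainDet_update_succ_of_le`), which reduces arbitrary constraints to weakly decreasing ones.

Transfer: when `T` equals the time of a past point, its constraint may be moved to the current point
with the same label (`chainDet_transfer`).

Start: at time `0` both sides are `1` or `0` according to whether all constraints are trivial
(`hasChainDet_zero`).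

Induction over the points combines these: evolve from the time of the last point to `T`, transfer
its constraint, repeat. Space-likeness is what keeps the current constraints on labels at most that
of the point being transferred. -/

theorem continuous_deriv_circleMap (c : ℂ) (r : ℝ) : Continuous (deriv (circleMap c r)) := by
  have : deriv (circleMap c r) = fun θ => circleMap 0 r θ * Complex.I := by
    ext θ; exact deriv_circleMap c r θ
  rw [this]; exact (continuous_circleMap 0 r).mul continuous_const

theorem circleIntegral_exp_hasDerivAt {c : ℂ} {r : ℝ} {g : ℂ → ℂ} (hr : 0 ≤ r)
    (hg : ContinuousOn g (Metric.sphere c r)) (t : ℝ) :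
    HasDerivAt (fun t : ℝ => ∮ w in C(c, r), Complex.exp ((t : ℂ) * w) * g w)
      (∮ w in C(c, r), Complex.exp ((t : ℂ) * w) * (w * g w)) t := by
  have hgc : Continuous fun θ : ℝ => g (circleMap c r θ) :=
    hg.comp_continuous (continuous_circleMap c r) fun θ => circleMap_mem_sphere c hr θ
  have hc := continuous_circleMap c r
  have hd := continuous_deriv_circleMap c r
  have hF' : Continuous fun p : ℝ × ℝ => deriv (circleMap c r) p.2 •
      (Complex.exp ((p.1 : ℂ) * circleMap c r p.2) *
        (circleMap c r p.2 * g (circleMap c r p.2))) := by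
    have h1 : Continuous fun p : ℝ × ℝ => circleMap c r p.2 := hc.comp continuous_snd
    have h2 : Continuous fun p : ℝ × ℝ => g (circleMap c r p.2) := hgc.comp continuous_snd
    have h3 : Continuous fun p : ℝ × ℝ => deriv (circleMap c r) p.2 := hd.comp continuous_snd
    exact h3.smul (((by fun_prop : Continuous fun p : ℝ × ℝ => (p.1 : ℂ)).mul h1).cexp.mul
      (h1.mul h2))
  have hF : ∀ s : ℝ, Continuous fun θ : ℝ => deriv (circleMap c r) θ •
      (Complex.exp ((s : ℂ) * circleMap c r θ) * g (circleMap c r θ)) := by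
    intro s; exact hd.smul ((continuous_const.mul hc).cexp.mul hgc)
  obtain ⟨C, hC⟩ := (isCompact_Icc.prod isCompact_Icc :
    IsCompact (Set.Icc (t - 1) (t + 1) ×ˢ Set.Icc 0 (2 * Real.pi))).exists_bound_of_continuousOn
      hF'.continuousOn
  refine (intervalIntegral.hasDerivAt_integral_of_dominated_loc_of_deriv_le (𝕜 := ℝ) (x₀ := t)
    (F := fun (s : ℝ) θ => deriv (circleMap c r) θ •
      (Complex.exp ((s : ℂ) * circleMap c r θ) * g (circleMap c r θ)))
    (F' := fun (s : ℝ) θ => deriv (circleMap c r) θ • (Complex.exp ((s : ℂ) * circleMap c r θ) *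
        (circleMap c r θ * g (circleMap c r θ))))
    (bound := fun _ => C) (s := Set.Icc (t - 1) (t + 1)) (Icc_mem_nhds (by linarith) (by linarith))
    (Filter.Eventually.of_forall fun s => (hF s).aestronglyMeasurable)
    ((hF t).intervalIntegrable _ _)
    (by exact (hF'.comp (Continuous.prodMk_right t)).aestronglyMeasurable) ?_
    intervalIntegrable_const ?_).2
  · refine Filter.Eventually.of_forall fun θ hθ s hs => hC (s, θ) ⟨hs, ?_⟩
    rw [Set.uIoc_of_le Real.two_pi_pos.le] at hθ
    exact ⟨hθ.1.le, hθ.2⟩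
  · refine Filter.Eventually.of_forall fun θ _ s _ => ?_
    have h1 : HasDerivAt (fun s : ℝ => Complex.exp ((s : ℂ) * circleMap c r θ))
        (Complex.exp ((s : ℂ) * circleMap c r θ) * (1 * circleMap c r θ)) s :=
      ((Complex.ofRealCLM.hasDerivAt (x := s)).mul_const _).cexp
    have h2 := (h1.mul_const (g (circleMap c r θ))).const_smul (deriv (circleMap c r) θ)
    rw [one_mul, mul_assoc] at h2
    exact h2

theorem circleIntegral_swap {c d : ℂ} {r R : ℝ} (hr : 0 ≤ r) (hR : 0 ≤ R) {f : ℂ → ℂ → ℂ}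
    (hf : ContinuousOn (fun p : ℂ × ℂ => f p.1 p.2) (Metric.sphere c r ×ˢ Metric.sphere d R)) :
    (∮ z in C(c, r), ∮ w in C(d, R), f z w) = ∮ w in C(d, R), ∮ z in C(c, r), f z w := by
  have hd := continuous_deriv_circleMap
  have hF : Continuous fun p : ℝ × ℝ => deriv (circleMap c r) p.1 • deriv (circleMap d R) p.2 •
      f (circleMap c r p.1) (circleMap d R p.2) := by
    have h1 : Continuous fun p : ℝ × ℝ => f (circleMap c r p.1) (circleMap d R p.2) := by
      refine hf.comp_continuous (f := fun p : ℝ × ℝ => (circleMap c r p.1, circleMap d R p.2))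
        ?_ fun p => ⟨circleMap_mem_sphere c hr _, circleMap_mem_sphere d hR _⟩
      exact ((continuous_circleMap c r).comp continuous_fst).prodMk
        ((continuous_circleMap d R).comp continuous_snd)
    have h2 := (hd c r).comp (continuous_fst (X := ℝ) (Y := ℝ))
    have h3 := (hd d R).comp (continuous_snd (X := ℝ) (Y := ℝ))
    exact h2.smul (h3.smul h1)
  simp only [circleIntegral]
  simp_rw [← intervalIntegral.integral_smul]
  simp_rw [intervalIntegral.integral_of_le Real.two_pi_pos.le]
  rw [integral_integral_swap]
  · simp_rw [smul_comm (deriv (circleMap c r) _)]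
  · rw [Measure.prod_restrict]
    exact (hF.continuousOn.integrableOn_compact
      (isCompact_Icc.prod isCompact_Icc : IsCompact (Set.Icc (0 : ℝ) (2 * Real.pi) ×ˢ
        Set.Icc (0 : ℝ) (2 * Real.pi)))).mono_set
      (Set.prod_mono Set.Ioc_subset_Icc_self Set.Ioc_subset_Icc_self)

theorem circleIntegral_eq_zero_of_differentiableOn {c : ℂ} {r : ℝ} (hr : 0 ≤ r) {f : ℂ → ℂ}
    (hf : ∀ z ∈ Metric.closedBall c r, DifferentiableAt ℂ f z) : ∮ z in C(c, r), f z = 0 :=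
  Complex.circleIntegral_eq_zero_of_differentiable_on_off_countable hr Set.countable_empty
    (fun z hz => (hf z hz).continuousAt.continuousWithinAt)
    fun z hz => hf z (Metric.ball_subset_closedBall hz.1)

/-- `(2πi)⁻¹ ∮_{|w| = r} e^{tw} (1 - w)^p w^{-u-1} dw`. -/
noncomputable def kernelPsi (r : ℝ) (p : ℤ) (t : ℝ) (u : ℤ) : ℂ :=
  (2 * Real.pi * Complex.I)⁻¹ *
    ∮ w in C(0, r), Complex.exp ((t : ℂ) * w) * ((1 - w) ^ p * w ^ (-u - 1))

/-- `(2πi)⁻¹ ∮_{|z - 1| = R} e^{-tz} (1 - z)^{-q} z^u dz`. -/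
noncomputable def kernelPhi (R : ℝ) (q : ℕ) (t : ℝ) (u : ℤ) : ℂ :=
  (2 * Real.pi * Complex.I)⁻¹ *
    ∮ z in C(1, R), Complex.exp ((t : ℂ) * (-z)) * (((1 - z) ^ q)⁻¹ * z ^ u)

section Contour

variable {r R : ℝ}

theorem ne_zero_of_mem_sphere_zero (hr : 0 < r) {w : ℂ} (hw : w ∈ Metric.sphere (0 : ℂ) r) :
    w ≠ 0 := by
  rintro rfl
  simp at hw
  exact hr.ne hw

theorem one_sub_ne_zero_of_mem_closedBall_zero (hr : r < 1) {w : ℂ}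
    (hw : w ∈ Metric.closedBall (0 : ℂ) r) : 1 - w ≠ 0 := by
  intro h
  rw [← sub_eq_zero.1 h] at hw
  simp at hw
  linarith

theorem ne_zero_of_mem_closedBall_one (hR : R < 1) {z : ℂ}
    (hz : z ∈ Metric.closedBall (1 : ℂ) R) : z ≠ 0 := by
  rintro rfl
  simp at hz
  linarith

theorem one_sub_ne_zero_of_mem_sphere_one (hR : 0 < R) {z : ℂ}
    (hz : z ∈ Metric.sphere (1 : ℂ) R) : 1 - z ≠ 0 := by
  intro h
  rw [← sub_eq_zero.1 h] at hz
  simp at hz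
  exact hR.ne hz

theorem sub_ne_zero_of_mem_closedBall (hrR : r + R < 1) {z w : ℂ}
    (hw : w ∈ Metric.closedBall (0 : ℂ) r) (hz : z ∈ Metric.closedBall (1 : ℂ) R) :
    w - z ≠ 0 := by
  intro h
  rw [sub_eq_zero] at h
  subst h
  rw [mem_closedBall_iff_norm, sub_zero] at hw
  rw [mem_closedBall_iff_norm] at hz
  have := norm_add_le w (1 - w)
  rw [norm_sub_rev w 1] at hz
  simp at this
  linarith

theorem continuousOn_kernelPsi_integrand (hr : 0 < r) (hr1 : r < 1) (p : ℤ) (u : ℤ) :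
    ContinuousOn (fun w : ℂ => (1 - w) ^ p * w ^ u) (Metric.sphere 0 r) := by
  refine ContinuousOn.mul ?_ ?_
  · exact (continuousOn_const.sub continuousOn_id).zpow₀ p fun w hw => Or.inl
      (one_sub_ne_zero_of_mem_closedBall_zero hr1 (Metric.sphere_subset_closedBall hw))
  · exact continuousOn_id.zpow₀ u fun w hw => Or.inl (ne_zero_of_mem_sphere_zero hr hw)

theorem continuousOn_kernelPhi_integrand (hR : 0 < R) (hR1 : R < 1) (q : ℕ) (u : ℤ) :
    ContinuousOn (fun z : ℂ => ((1 - z) ^ q)⁻¹ * z ^ u) (Metric.sphere 1 R) := by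
  refine ContinuousOn.mul ?_ ?_
  · exact ((continuousOn_const.sub continuousOn_id).pow q).inv₀ fun z hz =>
      pow_ne_zero _ (one_sub_ne_zero_of_mem_sphere_one hR hz)
  · exact continuousOn_id.zpow₀ u fun w hw => Or.inl
      (ne_zero_of_mem_closedBall_one hR1 (Metric.sphere_subset_closedBall hw))

theorem circleIntegrable_kernelPsi_integrand (hr : 0 < r) (hr1 : r < 1) (p : ℤ) (t : ℝ) (u : ℤ) :
    CircleIntegrable (fun w : ℂ => Complex.exp ((t : ℂ) * w) * ((1 - w) ^ p * w ^ u)) 0 r :=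
  ContinuousOn.circleIntegrable hr.le
    ((by fun_prop : Continuous fun w : ℂ => Complex.exp ((t : ℂ) * w)).continuousOn.mul
      (continuousOn_kernelPsi_integrand hr hr1 p u))

theorem circleIntegrable_kernelPhi_integrand (hR : 0 < R) (hR1 : R < 1) (q : ℕ) (t : ℝ) (u : ℤ) :
    CircleIntegrable
      (fun z : ℂ => Complex.exp ((t : ℂ) * (-z)) * (((1 - z) ^ q)⁻¹ * z ^ u)) 1 R :=
  ContinuousOn.circleIntegrable hR.le
    ((by fun_prop : Continuous fun z : ℂ => Complex.exp ((t : ℂ) * (-z))).continuousOn.mul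
      (continuousOn_kernelPhi_integrand hR hR1 q u))

/-- A factor `w` in the integrand shifts `u` by one, so a factor `1 - w` is a backward difference.
This and `kernelPhi_eq_sub` generate all recursions in the label. -/
theorem kernelPsi_add_one (hr : 0 < r) (hr1 : r < 1) (p : ℤ) (t : ℝ) (u : ℤ) :
    kernelPsi r (p + 1) t u = kernelPsi r p t u - kernelPsi r p t (u - 1) := by
  rw [kernelPsi, kernelPsi, kernelPsi, ← mul_sub, ← circleIntegral.integral_sub
    (circleIntegrable_kernelPsi_integrand hr hr1 p t _)
    (circleIntegrable_kernelPsi_integrand hr hr1 p t _)]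
  congr 1
  refine circleIntegral.integral_congr hr.le fun w hw => ?_
  have h1 := ne_zero_of_mem_sphere_zero hr hw
  have h2 := one_sub_ne_zero_of_mem_closedBall_zero hr1 (Metric.sphere_subset_closedBall hw)
  have h3 : w ^ (-(u - 1) - 1) = w ^ (-u - 1) * w := by
    rw [← zpow_add_one₀ h1]; congr 1; ring
  simp only [h3, zpow_add_one₀ h2]
  ring

theorem hasDerivAt_kernelPsi (hr : 0 < r) (hr1 : r < 1) (p : ℤ) (t : ℝ) (u : ℤ) :
    HasDerivAt (fun t => kernelPsi r p t u) (kernelPsi r p t (u - 1)) t := by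
  have h := (circleIntegral_exp_hasDerivAt hr.le
    (continuousOn_kernelPsi_integrand hr hr1 p (-u - 1)) t).const_mul (2 * Real.pi * Complex.I)⁻¹
  suffices e : kernelPsi r p t (u - 1) = (2 * Real.pi * Complex.I)⁻¹ *
      ∮ w in C(0, r), Complex.exp ((t : ℂ) * w) * (w * ((1 - w) ^ p * w ^ (-u - 1))) by
    rw [e]; exact h
  rw [kernelPsi]
  congr 1
  refine circleIntegral.integral_congr hr.le fun w hw => ?_
  have h1 := ne_zero_of_mem_sphere_zero hr hw
  have h3 : w ^ (-(u - 1) - 1) = w ^ (-u - 1) * w := by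
    rw [← zpow_add_one₀ h1]; congr 1; ring
  simp only [h3]
  ring

/-- For negative `u` the integrand has no pole at `0`. This one-sidedness is what makes all windows
finite. -/
theorem kernelPsi_of_neg (hr : 0 < r) (hr1 : r < 1) (p : ℤ) (t : ℝ) {u : ℤ} (hu : u < 0) :
    kernelPsi r p t u = 0 := by
  rw [kernelPsi, circleIntegral_eq_zero_of_differentiableOn hr.le, mul_zero]
  intro w hw
  have h2 := one_sub_ne_zero_of_mem_closedBall_zero hr1 hw
  have h3 : DifferentiableAt ℂ (fun w : ℂ => (1 - w) ^ p) w :=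
    ((differentiableAt_const _).sub differentiableAt_id).zpow (Or.inl h2)
  have h4 : DifferentiableAt ℂ (fun w : ℂ => w ^ (-u - 1)) w :=
    differentiableAt_id.zpow (Or.inr (by omega))
  exact (by fun_prop : DifferentiableAt ℂ (fun w : ℂ => Complex.exp ((t : ℂ) * w)) w).mul
    (h3.mul h4)

theorem kernelPsi_zero_zero (hr : 0 < r) (u : ℤ) :
    kernelPsi r 0 0 u = if u = 0 then 1 else 0 := by
  rw [kernelPsi]
  have : (∮ w in C(0, r), Complex.exp (((0 : ℝ) : ℂ) * w) * ((1 - w) ^ (0 : ℤ) * w ^ (-u - 1))) =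
      ∮ w in C(0, r), (w - 0) ^ (-u - 1) := by simp
  rw [this]
  split_ifs with h
  · subst h
    have := circleIntegral.integral_sub_center_inv 0 hr.ne'
    simp only [sub_zero, neg_zero, zero_sub, zpow_neg_one] at this ⊢
    rw [this]
    exact inv_mul_cancel₀ Complex.two_pi_I_ne_zero
  · rw [circleIntegral.integral_sub_zpow_of_ne (by omega), mul_zero]

theorem kernelPhi_zero (hR : 0 < R) (hR1 : R < 1) (t : ℝ) (u : ℤ) : kernelPhi R 0 t u = 0 := by
  rw [kernelPhi, circleIntegral_eq_zero_of_differentiableOn hR.le, mul_zero]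
  intro z hz
  have h4 : DifferentiableAt ℂ (fun w : ℂ => w ^ u) z :=
    differentiableAt_id.zpow (Or.inl (ne_zero_of_mem_closedBall_one hR1 hz))
  simp only [pow_zero, inv_one, one_mul]
  exact (by fun_prop : DifferentiableAt ℂ (fun z : ℂ => Complex.exp ((t : ℂ) * (-z))) z).mul h4

theorem kernelPhi_eq_sub (hR : 0 < R) (hR1 : R < 1) (q : ℕ) (t : ℝ) (u : ℤ) :
    kernelPhi R q t u = kernelPhi R (q + 1) t u - kernelPhi R (q + 1) t (u + 1) := by
  rw [kernelPhi, kernelPhi, kernelPhi, ← mul_sub, ← circleIntegral.integral_sub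
    (circleIntegrable_kernelPhi_integrand hR hR1 _ t _)
    (circleIntegrable_kernelPhi_integrand hR hR1 _ t _)]
  congr 1
  refine circleIntegral.integral_congr hR.le fun z hz => ?_
  have h1 := ne_zero_of_mem_closedBall_one hR1 (Metric.sphere_subset_closedBall hz)
  have h2 := one_sub_ne_zero_of_mem_sphere_one hR hz
  simp only [zpow_add_one₀ h1]
  field_simp
  ring

theorem hasDerivAt_kernelPhi (hR : 0 < R) (hR1 : R < 1) (q : ℕ) (t : ℝ) (u : ℤ) :
    HasDerivAt (fun t => kernelPhi R q t u) (-kernelPhi R q t (u + 1)) t := by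
  have h := (circleIntegral_exp_hasDerivAt hR.le
    (continuousOn_kernelPhi_integrand hR hR1 q u) (-t)).const_mul (2 * Real.pi * Complex.I)⁻¹
  have h' := h.scomp t (hasDerivAt_neg t)
  have e : ∀ (t : ℝ) (z : ℂ), ((-t : ℝ) : ℂ) * z = (t : ℂ) * (-z) := by
    intro t z; push_cast; ring
  suffices e2 : kernelPhi R q t (u + 1) = (2 * Real.pi * Complex.I)⁻¹ *
      ∮ w in C(1, R), Complex.exp (((-t : ℝ) : ℂ) * w) * (w * (((1 - w) ^ q)⁻¹ * w ^ u)) by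
    rw [e2, ← neg_one_smul ℝ]
    have e3 : (fun t => kernelPhi R q t u) = fun t : ℝ => (2 * Real.pi * Complex.I)⁻¹ *
      ∮ w in C(1, R), Complex.exp (((-t : ℝ) : ℂ) * w) * (((1 - w) ^ q)⁻¹ * w ^ u) := by
      ext t
      simp only [kernelPhi, e]
    rw [e3]
    exact h'
  rw [kernelPhi]
  congr 1
  refine circleIntegral.integral_congr hR.le fun z hz => ?_
  have h1 := ne_zero_of_mem_closedBall_one hR1 (Metric.sphere_subset_closedBall hz)
  simp only [zpow_add_one₀ h1, e]
  ring

/-- At `t = u = 0` the integrand is a pure power of `1 - z`, and only a simple pole has a residue.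
-/
theorem kernelPhi_zero_zero (hR : 0 < R) (q : ℕ) :
    kernelPhi R q 0 0 = if q = 1 then -1 else 0 := by
  rw [kernelPhi]
  have : (∮ z in C(1, R), Complex.exp (((0 : ℝ) : ℂ) * (-z)) * (((1 - z) ^ q)⁻¹ * z ^ (0 : ℤ))) =
      (-1) ^ q * ∮ z in C(1, R), (z - 1) ^ (-(q : ℤ)) := by
    rw [← circleIntegral.integral_const_mul]
    refine circleIntegral.integral_congr hR.le fun z hz => ?_
    have : (1 - z) ^ q = (-1) ^ q * (z - 1) ^ q := by rw [← mul_pow]; ring_nf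
    have h1 : ((-1 : ℂ) ^ q)⁻¹ = (-1) ^ q := by rw [← inv_pow]; norm_num
    simp [this, mul_comm, h1]
  rw [this]
  split_ifs with h
  · subst h
    have := circleIntegral.integral_sub_center_inv 1 hR.ne'
    simp only [Nat.cast_one, zpow_neg_one] at this ⊢
    rw [this]
    have := Complex.two_pi_I_ne_zero
    field_simp
  · rw [circleIntegral.integral_sub_zpow_of_ne (by omega), mul_zero, mul_zero]

/-- The finite-rank part `∑ₖ Ψₖ Φₖ` of the kernel, in coordinates shifted by the label. -/
noncomputable def kernelRank (r R : ℝ) (n : ℕ) (t : ℝ) (u : ℤ) (n' : ℕ) (t' : ℝ) (u' : ℤ) : ℂ :=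
  ∑ k ∈ Finset.range n', kernelPsi r (n - k - 1) t u * kernelPhi R (n' - k) t' u'

/-- Used with `a = 1 - w`, `b = 1 - z`. The remainder carries `(1 - z) ^ q`, which cancels a pole of
order `q` at `z = 1`. -/
theorem inv_sub_eq_geom_sum {a b : ℂ} (ha : a ≠ 0) (hab : b - a ≠ 0) (q : ℕ) :
    1 / (b - a) = -∑ k ∈ Finset.range q, b ^ k / a ^ (k + 1) + (b / a) ^ q / (b - a) := by
  induction q with
  | zero => simp
  | succ q ih =>
    rw [ih, Finset.sum_range_succ]
    have : (b / a) ^ q / (b - a) = -(b ^ q / a ^ (q + 1)) + (b / a) ^ (q + 1) / (b - a) := by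
      rw [div_pow, div_pow]
      field_simp
      ring
    rw [this]
    ring

/-- Truncating the geometric expansion of `1 / (w - z)` at the pole order `n'` leaves a remainder
analytic in `z` on the disc around `1`, so its integral vanishes. Each remaining term separates the
two variables. -/
theorem circleIntegral_circleIntegral_eq_neg_kernelRank (hr : 0 < r) (hR : 0 < R)
    (hrR : r + R < 1) (n : ℕ) (t : ℝ) (x : ℤ) (n' : ℕ) (t' : ℝ) (x' : ℤ) :
    ((2 * Real.pi * Complex.I) ^ 2)⁻¹ *
      ∮ z in C(1, R), ∮ w in C(0, r),
        (Complex.exp ((t : ℂ) * w) * (1 - w) ^ n / w ^ (x + (n : ℤ) + 1)) *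
        (z ^ (x' + (n' : ℤ)) / (Complex.exp ((t' : ℂ) * z) * (1 - z) ^ n')) * (1 / (w - z)) =
      -kernelRank r R n t (x + n) n' t' (x' + n') := by
  have hr1 : r < 1 := by linarith
  have hR1 : R < 1 := by linarith
  rw [circleIntegral_swap hR.le hr.le]
  swap
  · refine ContinuousOn.mul (ContinuousOn.mul ?_ ?_) ?_
    · refine ContinuousOn.div (by fun_prop) ?_ ?_
      · exact continuousOn_snd.zpow₀ _ fun p hp => Or.inl (ne_zero_of_mem_sphere_zero hr hp.2)
      · exact fun p hp => zpow_ne_zero _ (ne_zero_of_mem_sphere_zero hr hp.2)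
    · refine ContinuousOn.div ?_ (by fun_prop) ?_
      · exact continuousOn_fst.zpow₀ _ fun p hp => Or.inl
          (ne_zero_of_mem_closedBall_one hR1 (Metric.sphere_subset_closedBall hp.1))
      · exact fun p hp => mul_ne_zero (Complex.exp_ne_zero _)
          (pow_ne_zero _ (one_sub_ne_zero_of_mem_sphere_one hR hp.1))
    · refine ContinuousOn.div (by fun_prop) (by fun_prop) fun p hp => ?_
      exact sub_ne_zero_of_mem_closedBall hrR (Metric.sphere_subset_closedBall hp.2)
        (Metric.sphere_subset_closedBall hp.1)
  -- With the `w` integral outermost, the inner integral over `z` is evaluated for each fixed `w`.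
  have hinner : ∀ w ∈ Metric.sphere (0 : ℂ) r, (∮ z in C(1, R),
        (Complex.exp ((t : ℂ) * w) * (1 - w) ^ n / w ^ (x + (n : ℤ) + 1)) *
        (z ^ (x' + (n' : ℤ)) / (Complex.exp ((t' : ℂ) * z) * (1 - z) ^ n')) * (1 / (w - z))) =
      ∑ k ∈ Finset.range n', (-(2 * Real.pi * Complex.I) *
        kernelPhi R (n' - k) t' (x' + n')) *
        (Complex.exp ((t : ℂ) * w) * ((1 - w) ^ ((n : ℤ) - k - 1) * w ^ (-(x + n) - 1))) := by
    intro w hw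
    have hw0 := ne_zero_of_mem_sphere_zero hr hw
    have hw1 := one_sub_ne_zero_of_mem_closedBall_zero hr1 (Metric.sphere_subset_closedBall hw)
    have hwz : ∀ z ∈ Metric.closedBall (1 : ℂ) R, w - z ≠ 0 := fun z hz =>
      sub_ne_zero_of_mem_closedBall hrR (Metric.sphere_subset_closedBall hw) hz
    set A : ℕ → ℂ := fun k =>
      Complex.exp ((t : ℂ) * w) * ((1 - w) ^ ((n : ℤ) - k - 1) * w ^ (-(x + n) - 1)) with hA
    set B : ℂ := Complex.exp ((t : ℂ) * w) * (1 - w) ^ n / w ^ (x + (n : ℤ) + 1) / (1 - w) ^ n'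
      with hB
    have hdiff : ∀ z ∈ Metric.closedBall (1 : ℂ) R, DifferentiableAt ℂ
        (fun z : ℂ => Complex.exp ((t' : ℂ) * (-z)) * z ^ (x' + (n' : ℤ)) * (1 / (w - z))) z := by
      intro z hz
      have h4 : DifferentiableAt ℂ (fun z : ℂ => z ^ (x' + (n' : ℤ))) z :=
        differentiableAt_id.zpow (Or.inl (ne_zero_of_mem_closedBall_one hR1 hz))
      have h5 : DifferentiableAt ℂ (fun z : ℂ => 1 / (w - z)) z :=
        (differentiableAt_const _).div (by fun_prop) (hwz z hz)
      exact ((by fun_prop : DifferentiableAt ℂ (fun z : ℂ => Complex.exp ((t' : ℂ) * (-z))) z).mul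
        h4).mul h5
    have hsplit : ∀ z ∈ Metric.sphere (1 : ℂ) R,
        (Complex.exp ((t : ℂ) * w) * (1 - w) ^ n / w ^ (x + (n : ℤ) + 1)) *
        (z ^ (x' + (n' : ℤ)) / (Complex.exp ((t' : ℂ) * z) * (1 - z) ^ n')) * (1 / (w - z)) =
        (∑ k ∈ Finset.range n', (-A k) * (Complex.exp ((t' : ℂ) * (-z)) *
          (((1 - z) ^ (n' - k))⁻¹ * z ^ (x' + (n' : ℤ))))) +
        B * (Complex.exp ((t' : ℂ) * (-z)) * z ^ (x' + (n' : ℤ)) * (1 / (w - z))) := by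
      intro z hz
      have hz1 := one_sub_ne_zero_of_mem_sphere_one hR hz
      have hz2 := hwz z (Metric.sphere_subset_closedBall hz)
      have hg := inv_sub_eq_geom_sum hw1 (b := 1 - z) (by rwa [sub_sub_sub_cancel_left]) n'
      rw [show (1 - z) - (1 - w) = w - z by ring] at hg
      have hexp : Complex.exp ((t' : ℂ) * (-z)) = (Complex.exp ((t' : ℂ) * z))⁻¹ := by
        rw [← Complex.exp_neg]; congr 1; ring
      conv_lhs => rw [hg]
      rw [mul_add, mul_neg, Finset.mul_sum, ← Finset.sum_neg_distrib]
      congr 1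
      · refine Finset.sum_congr rfl fun k hk => ?_
        rw [Finset.mem_range] at hk
        have e1 : (1 - w) ^ ((n : ℤ) - k - 1) = (1 - w) ^ n / (1 - w) ^ (k + 1) := by
          rw [sub_sub, zpow_sub₀ hw1, zpow_natCast]; norm_cast
        have e2 : w ^ (-(x + (n : ℤ)) - 1) = (w ^ (x + (n : ℤ) + 1))⁻¹ := by
          rw [← zpow_neg]; congr 1; ring
        have e3 : (1 - z) ^ n' = (1 - z) ^ (n' - k) * (1 - z) ^ k := by
          rw [← pow_add]; congr 1; omega
        have := zpow_ne_zero (x + (n : ℤ) + 1) hw0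
        have := Complex.exp_ne_zero ((t' : ℂ) * z)
        rw [hA]
        simp only [e1, e2, e3, hexp]
        field_simp
      · have := zpow_ne_zero (x + (n : ℤ) + 1) hw0
        have := Complex.exp_ne_zero ((t' : ℂ) * z)
        rw [hB, hexp, div_pow]
        field_simp
    rw [circleIntegral.integral_congr hR.le hsplit, circleIntegral.integral_add,
      circleIntegral.integral_fun_sum, circleIntegral.integral_const_mul,
      circleIntegral_eq_zero_of_differentiableOn hR.le hdiff, mul_zero, add_zero]
    · refine Finset.sum_congr rfl fun k _ => ?_
      rw [circleIntegral.integral_const_mul, kernelPhi]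
      have := Complex.two_pi_I_ne_zero
      rw [← mul_assoc (-(2 * Real.pi * Complex.I)), neg_mul (2 * Real.pi * Complex.I),
        mul_inv_cancel₀ this]
      ring
    · intro k _
      exact (circleIntegrable_kernelPhi_integrand hR hR1 _ t' _).const_smul
    · refine CircleIntegrable.fun_sum _ fun k _ => ?_
      exact (circleIntegrable_kernelPhi_integrand hR hR1 _ t' _).const_smul
    · refine ContinuousOn.circleIntegrable hR.le (continuousOn_const.mul fun z hz => ?_)
      exact (hdiff z (Metric.sphere_subset_closedBall hz)).continuousAt.continuousWithinAt
  rw [circleIntegral.integral_congr hr.le hinner, circleIntegral.integral_fun_sum]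
  · rw [kernelRank, Finset.mul_sum, ← Finset.sum_neg_distrib]
    refine Finset.sum_congr rfl fun k _ => ?_
    rw [circleIntegral.integral_const_mul, kernelPsi]
    have := Complex.two_pi_I_ne_zero
    field_simp
  · intro k _
    exact (circleIntegrable_kernelPsi_integrand hr hr1 _ t _).const_smul

theorem tasepKernel_eq (hr : 0 < r) (hR : 0 < R) (hrR : r + R < 1) (n : ℕ) (t : ℝ) (x : ℤ)
    (n' : ℕ) (t' : ℝ) (x' : ℤ) [Decidable (SpaceLikePrec (n', t') (n, t))] :
    tasepKernel r R n t x n' t' x' =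
      -((if SpaceLikePrec (n', t') (n, t) then
          kernelPsi r (n - n') (t - t') ((x + n) - (x' + n')) else 0) +
        kernelRank r R n t (x + n) n' t' (x' + n')) := by
  rw [tasepKernel, circleIntegral_circleIntegral_eq_neg_kernelRank hr hR hrR, neg_add]
  congr 2
  split_ifs with h
  swap
  · rfl
  rw [kernelPsi]
  congr 1
  refine circleIntegral.integral_congr hr.le fun w hw => ?_
  have hw0 := ne_zero_of_mem_sphere_zero hr hw
  have hw1 : 1 - w ≠ 0 := one_sub_ne_zero_of_mem_closedBall_zero (by linarith)
    (Metric.sphere_subset_closedBall hw)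
  have e1 : (1 - w) ^ ((n : ℤ) - n') = ((1 - w) ^ ((n' : ℤ) - n))⁻¹ := by
    rw [← zpow_neg]; congr 1; ring
  have e2 : w ^ (-(x + n - (x' + n')) - 1 : ℤ) =
      w ^ ((n' : ℤ) - n) * (w ^ (x - x' + 1))⁻¹ := by
    rw [← zpow_neg, ← zpow_add₀ hw0]; congr 1; ring
  simp only [e1, e2, div_zpow]
  field_simp

end Contour

/-! ### Determinants of finite principal submatrices -/

section MinorDet

variable {I : Type*} [DecidableEq I]

/-- The principal submatrix of `M` on the finite set `W`. -/
def subMatrix (M : I → I → ℂ) (W : Finset I) : Matrix W W ℂ :=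
  Matrix.of fun p q => M p q

/-- The principal minor of `M` on the finite set `W`. -/
def minorDet (M : I → I → ℂ) (W : Finset I) : ℂ := (subMatrix M W).det

theorem minorDet_swap (M : I → I → ℂ) (W : Finset I) :
    minorDet (fun p q => M q p) W = minorDet M W := by
  rw [minorDet, minorDet, ← Matrix.det_transpose]
  rfl

/-- Both sides are the diagonal entry of the adjugate at `i`. -/
theorem det_updateCol_single_eq {n : Type*} [Fintype n] [DecidableEq n] (A : Matrix n n ℂ)
    (i : n) : (A.updateCol i (Pi.single i 1)).det = (A.updateRow i (Pi.single i 1)).det := by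
  rw [← Matrix.adjugate_apply, ← Matrix.det_transpose, Matrix.updateRow_transpose.symm,
    ← Matrix.adjugate_apply, ← Matrix.adjugate_transpose, Matrix.transpose_apply]

/-- With row `i` replaced by a unit vector the matrix is block triangular, with blocks the smaller
minor and `1`. -/
theorem minorDet_erase (M : I → I → ℂ) {W : Finset I} {i : I} (hi : i ∈ W) :
    minorDet M (W.erase i) =
      ((subMatrix M W).updateRow ⟨i, hi⟩ (Pi.single ⟨i, hi⟩ 1)).det := by
  set A := (subMatrix M W).updateRow ⟨i, hi⟩ (Pi.single ⟨i, hi⟩ 1) with hA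
  rw [Matrix.twoBlockTriangular_det A (fun x => x ≠ ⟨i, hi⟩)]
  · have h2 : (A.toSquareBlockProp fun x => ¬ x ≠ ⟨i, hi⟩) = 1 := by
      ext ⟨x, hx⟩ ⟨y, hy⟩
      have hx' := not_not.1 hx
      have hy' := not_not.1 hy
      subst hx' hy'
      simp [Matrix.toSquareBlockProp_def, hA]
    rw [h2, Matrix.det_one, mul_one, minorDet]
    let e : {x : W // x ≠ ⟨i, hi⟩} ≃ (W.erase i : Finset I) :=
      { toFun := fun x => ⟨x.1.1, Finset.mem_erase.2
          ⟨fun h => x.2 (Subtype.ext h), x.1.2⟩⟩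
        invFun := fun x => ⟨⟨x.1, Finset.mem_of_mem_erase x.2⟩, fun h =>
          Finset.ne_of_mem_erase x.2 (congrArg Subtype.val h)⟩
        left_inv := fun x => rfl
        right_inv := fun x => rfl }
    rw [← Matrix.det_submatrix_equiv_self e]
    congr 1
    ext ⟨x, hx⟩ y
    simp [Matrix.toSquareBlockProp_def, hA, e, subMatrix, Matrix.updateRow_ne hx]
  · intro x hx y hy
    rw [not_not.1 hx]
    simp [hA, hy]

theorem minorDet_erase' (M : I → I → ℂ) {W : Finset I} {i : I} (hi : i ∈ W) :
    minorDet M (W.erase i) =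
      ((subMatrix M W).updateCol ⟨i, hi⟩ (Pi.single ⟨i, hi⟩ 1)).det := by
  rw [minorDet_erase M hi, det_updateCol_single_eq]

/-- If the `i`-th column minus a combination of other columns of the window is replaced by that
difference minus a unit vector, the determinant is the difference of two minors. -/
theorem det_updateCol_eq_minorDet_sub (M : I → I → ℂ) {W S : Finset I} {i : I} (hi : i ∈ W)
    (hS : S ⊆ W) (hiS : i ∉ S) (v : W → ℂ)
    (h : ∀ p : W, v p = M p i - ∑ j ∈ S, M p j - if (p : I) = i then 1 else 0) :
    ((subMatrix M W).updateCol ⟨i, hi⟩ v).det = minorDet M W - minorDet M (W.erase i) := by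
  classical
  set A := subMatrix M W
  let c : W → ℂ := fun k => (if (k : I) = i then 1 else 0) - if (k : I) ∈ S then 1 else 0
  have hv : v = (fun p => ∑ k, c k • A p k) + (-1 : ℂ) • Pi.single ⟨i, hi⟩ 1 := by
    ext p
    simp only [Pi.add_apply, c, sub_smul, Finset.sum_sub_distrib, ite_smul, one_smul, zero_smul,
      Pi.smul_apply]
    have e1 : (∑ k : W, if (k : I) = i then A p k else 0) = M p i := by
      rw [Finset.sum_eq_single ⟨i, hi⟩] <;> simp +contextual [A, subMatrix, Subtype.ext_iff]
    have e2 : (∑ k : W, if (k : I) ∈ S then A p k else 0) = ∑ j ∈ S, M p j := by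
      refine (Finset.sum_coe_sort W (fun k => if k ∈ S then M p k else 0)).trans ?_
      rw [← Finset.sum_filter]
      congr 1
      ext x
      simp only [Finset.mem_filter]
      exact ⟨fun h => h.2, fun h => ⟨hS h, h⟩⟩
    have e3 : (Pi.single ⟨i, hi⟩ 1 : W → ℂ) p = if (p : I) = i then 1 else 0 := by
      simp [Pi.single_apply, Subtype.ext_iff]
    rw [e1, e2, e3, h p, smul_eq_mul]
    ring
  rw [hv, Matrix.det_updateCol_add, Matrix.det_updateCol_smul, Matrix.det_updateCol_sum,
    ← minorDet_erase' M hi]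
  simp [c, hiS, minorDet, A]
  ring

/-- Column operations turn column `i` into a unit vector, so the site `i` can be dropped. In the
application this expresses that a constraint is redundant. -/
theorem minorDet_erase_eq_of_col (M : I → I → ℂ) {W S : Finset I} {i : I} (hi : i ∈ W)
    (hS : S ⊆ W) (hiS : i ∉ S)
    (h : ∀ p ∈ W, M p i - (if p = i then 1 else 0) = ∑ j ∈ S, M p j) :
    minorDet M (W.erase i) = minorDet M W := by
  have := det_updateCol_eq_minorDet_sub M hi hS hiS 0 (fun p => by
    rw [← h p p.2]; simp)
  rw [Matrix.det_eq_zero_of_column_eq_zero ⟨i, hi⟩ (by simp)] at this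
  exact (sub_eq_zero.1 this.symm).symm

theorem minorDet_erase_eq_of_row (M : I → I → ℂ) {W S : Finset I} {i : I} (hi : i ∈ W)
    (hS : S ⊆ W) (hiS : i ∉ S)
    (h : ∀ q ∈ W, M i q - (if i = q then 1 else 0) = ∑ j ∈ S, M j q) :
    minorDet M (W.erase i) = minorDet M W := by
  rw [← minorDet_swap M, ← minorDet_swap M]
  refine minorDet_erase_eq_of_col _ hi hS hiS fun p hp => ?_
  rw [← h p hp]
  simp only [eq_comm]

/-- Both sums are the trace of the product of the adjugate of `A` with `B`. -/
theorem sum_det_updateCol_eq_sum_det_updateRow {n : Type*} [Fintype n] [DecidableEq n]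
    (A B : Matrix n n ℂ) :
    ∑ q, (A.updateCol q fun p => B p q).det = ∑ p, (A.updateRow p (B p)).det := by
  simp_rw [← Matrix.cramer_apply, ← Matrix.cramer_transpose_apply,
    Matrix.cramer_eq_adjugate_mulVec, ← Matrix.adjugate_transpose, Matrix.mulVec, dotProduct,
    Matrix.transpose_apply]
  exact Finset.sum_comm

theorem hasDerivAt_det {n : Type*} [Fintype n] [DecidableEq n] {A : ℝ → Matrix n n ℂ}
    {A' : Matrix n n ℂ} {t : ℝ} (h : ∀ i j, HasDerivAt (fun t => A t i j) (A' i j) t) :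
    HasDerivAt (fun t => (A t).det) (∑ j, ((A t).updateCol j fun i => A' i j).det) t := by
  simp only [Matrix.det_apply]
  rw [Finset.sum_comm]
  refine HasDerivAt.fun_sum fun σ _ => ?_
  rw [← Finset.smul_sum]
  refine HasDerivAt.const_smul _ ?_
  refine (HasDerivAt.fun_finsetProd fun i _ => h (σ i) i).congr_deriv ?_
  refine Finset.sum_congr rfl fun k _ => ?_
  rw [← Finset.mul_prod_erase _ _ (Finset.mem_univ k), Matrix.updateCol_self, smul_eq_mul, mul_comm]
  congr 1
  exact Finset.prod_congr rfl fun i hi => (Matrix.updateCol_ne (Finset.ne_of_mem_erase hi)).symm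

end MinorDet

/-! ### Windows -/

section Window

variable {ι : Type*}

/-- The sites `(a, u)` with `a ∈ A` and `0 ≤ u < c a`. -/
noncomputable def siteWindow (A : Finset ι) (c : ι → ℕ) : Finset (ι × ℤ) :=
  (A.sigma fun a => Finset.Ico (0 : ℤ) (c a)).map (Equiv.sigmaEquivProd ι ℤ).toEmbedding

theorem mem_siteWindow {A : Finset ι} {c : ι → ℕ} {p : ι × ℤ} :
    p ∈ siteWindow A c ↔ p.1 ∈ A ∧ 0 ≤ p.2 ∧ p.2 < c p.1 := by
  obtain ⟨a, u⟩ := p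
  simp [siteWindow]

theorem sum_siteWindow (A : Finset ι) (c : ι → ℕ) (f : ι × ℤ → ℂ) :
    ∑ p ∈ siteWindow A c, f p = ∑ a ∈ A, ∑ u ∈ Finset.Ico (0 : ℤ) (c a), f (a, u) := by
  rw [siteWindow, Finset.sum_map, Finset.sum_sigma]
  rfl

theorem siteWindow_update_erase [DecidableEq ι] (A : Finset ι) (c : ι → ℕ) (a : ι) (v : ℕ) :
    (siteWindow A (Function.update c a (v + 1))).erase (a, (v : ℤ)) =
      siteWindow A (Function.update c a v) := by
  ext ⟨b, u⟩
  simp only [Finset.mem_erase, mem_siteWindow, ne_eq, Prod.mk.injEq, not_and]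
  by_cases hb : b = a
  · subst hb
    simp only [Function.update_self]
    push_cast
    constructor
    · rintro ⟨h1, h2, h3, h4⟩
      have h5 : u ≠ v := by simpa using h1
      exact ⟨h2, h3, by omega⟩
    · rintro ⟨h2, h3, h4⟩
      exact ⟨fun _ => by omega, h2, h3, by omega⟩
  · simp [hb]

end Window

/-! ### Recursions, derivatives and initial value of the finite-rank part -/

section Rank

variable {r R : ℝ}

theorem kernelRank_label_succ_left (hr : 0 < r) (hr1 : r < 1) (n : ℕ) (t : ℝ) (u : ℤ) (n' : ℕ)
    (t' : ℝ) (u' : ℤ) :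
    kernelRank r R (n + 1) t u n' t' u' =
      kernelRank r R n t u n' t' u' - kernelRank r R n t (u - 1) n' t' u' := by
  rw [kernelRank, kernelRank, kernelRank, ← Finset.sum_sub_distrib]
  refine Finset.sum_congr rfl fun k _ => ?_
  have := kernelPsi_add_one hr hr1 ((n : ℤ) - k - 1) t u
  rw [← sub_mul, ← this]
  congr 2
  push_cast
  ring

/-- The sum for label `n' + 1` has one more term, `k = n'`. Its difference in `u'` is `kernelPhi`
with exponent `0`, which vanishes for lack of a pole. -/
theorem kernelRank_label_succ_right (hR : 0 < R) (hR1 : R < 1) (n : ℕ) (t : ℝ) (u : ℤ) (n' : ℕ)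
    (t' : ℝ) (u' : ℤ) :
    kernelRank r R n t u n' t' u' =
      kernelRank r R n t u (n' + 1) t' u' - kernelRank r R n t u (n' + 1) t' (u' + 1) := by
  rw [kernelRank, kernelRank, kernelRank, ← Finset.sum_sub_distrib, Finset.sum_range_succ,
    ← mul_sub, Nat.add_sub_cancel_left]
  have h0 := kernelPhi_eq_sub hR hR1 0 t' u'
  rw [zero_add, kernelPhi_zero hR hR1] at h0
  rw [← h0, mul_zero, add_zero]
  refine Finset.sum_congr rfl fun k hk => ?_
  rw [Finset.mem_range] at hk
  rw [← mul_sub, kernelPhi_eq_sub hR hR1]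
  congr <;> omega

theorem kernelRank_of_neg (hr : 0 < r) (hr1 : r < 1) (n : ℕ) (t : ℝ) {u : ℤ} (hu : u < 0) (n' : ℕ)
    (t' : ℝ) (u' : ℤ) : kernelRank r R n t u n' t' u' = 0 := by
  rw [kernelRank]
  exact Finset.sum_eq_zero fun k _ => by rw [kernelPsi_of_neg hr hr1 _ _ hu, zero_mul]

theorem kernelRank_label_zero (n : ℕ) (t : ℝ) (u : ℤ) (t' : ℝ) (u' : ℤ) :
    kernelRank r R n t u 0 t' u' = 0 := by
  simp [kernelRank]

theorem hasDerivAt_kernelRank_left (hr : 0 < r) (hr1 : r < 1) (n : ℕ) (t : ℝ) (u : ℤ) (n' : ℕ)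
    (t' : ℝ) (u' : ℤ) :
    HasDerivAt (fun t => kernelRank r R n t u n' t' u')
      (kernelRank r R n t (u - 1) n' t' u') t := by
  simp only [kernelRank]
  exact HasDerivAt.fun_sum fun k _ => (hasDerivAt_kernelPsi hr hr1 _ t u).mul_const _

theorem hasDerivAt_kernelRank_right (hR : 0 < R) (hR1 : R < 1) (n : ℕ) (t : ℝ) (u : ℤ) (n' : ℕ)
    (t' : ℝ) (u' : ℤ) :
    HasDerivAt (fun t' => kernelRank r R n t u n' t' u')
      (-kernelRank r R n t u n' t' (u' + 1)) t' := by
  simp only [kernelRank]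
  rw [← Finset.sum_neg_distrib]
  refine HasDerivAt.fun_sum fun k _ => ?_
  exact ((hasDerivAt_kernelPhi hR hR1 _ t' u').const_mul _).congr_deriv (by ring)

theorem hasDerivAt_kernelRank (hr : 0 < r) (hr1 : r < 1) (hR : 0 < R) (hR1 : R < 1) (n : ℕ)
    (t : ℝ) (u : ℤ) (n' : ℕ) (u' : ℤ) :
    HasDerivAt (fun t => kernelRank r R n t u n' t u')
      (kernelRank r R n t (u - 1) n' t u' - kernelRank r R n t u n' t (u' + 1)) t := by
  simp only [kernelRank]
  rw [← Finset.sum_sub_distrib]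
  refine HasDerivAt.fun_sum fun k _ => ?_
  exact ((hasDerivAt_kernelPsi hr hr1 _ t u).mul (hasDerivAt_kernelPhi hR hR1 _ t u')).congr_deriv
    (by ring)

/-- Only the term with a simple pole, `k = n - 1`, survives at time `0` and site `0`. -/
theorem kernelRank_zero_zero (hR : 0 < R) (a : ℕ) (u : ℤ) {n : ℕ} (hn : 1 ≤ n) :
    kernelRank r R a 0 u n 0 0 = -kernelPsi r (a - n) 0 u := by
  rw [kernelRank, Finset.sum_eq_single (n - 1)]
  · rw [kernelPhi_zero_zero hR, if_pos (by omega)]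
    have : (a : ℤ) - (n - 1 : ℕ) - 1 = a - n := by omega
    rw [this]
    ring
  · intro k hk hkn
    rw [Finset.mem_range] at hk
    rw [kernelPhi_zero_zero hR, if_neg (by omega), mul_zero]
  · intro h
    simp at h
    omega

end Rank

/-! ### The matrix `1 - K` in shifted coordinates -/

open Classical in
/-- The entries of `1 - K` at the points `a` with label `lab a` and time `tim a`, ordered by `prec`;
the second coordinate of a site is position plus label. -/
noncomputable def siteMatrix (r R : ℝ) {ι : Type*} (lab : ι → ℕ) (tim : ι → ℝ)
    (prec : ι → ι → Prop) (p q : ι × ℤ) : ℂ :=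
  (if p = q then 1 else 0) +
  (if prec q.1 p.1 then
    kernelPsi r (lab p.1 - lab q.1) (tim p.1 - tim q.1) (p.2 - q.2) else 0) +
  kernelRank r R (lab p.1) (tim p.1) p.2 (lab q.1) (tim q.1) q.2

/-- `1 - K` for past points `Sum.inl i`, and for all labels `Sum.inr j` at the current time `T`. -/
noncomputable abbrev chainMatrix (r R : ℝ) {m : ℕ} (n : Fin m → ℕ) (t : Fin m → ℝ) (T : ℝ) :
    (Fin m ⊕ ℕ) × ℤ → (Fin m ⊕ ℕ) × ℤ → ℂ :=
  siteMatrix r R (Sum.elim n id) (Sum.elim t fun _ => T) (Sum.Lex (· < ·) (· > ·))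

/-- All past points, and the current points with labels `1, …, N`. -/
def chainPoints (m N : ℕ) : Finset (Fin m ⊕ ℕ) := Finset.univ.disjSum (Finset.Icc 1 N)

/-- `det (1 - K)` on the window `c`. -/
noncomputable def chainDet (r R : ℝ) {m : ℕ} (n : Fin m → ℕ) (t : Fin m → ℝ) (N : ℕ) (T : ℝ)
    (c : Fin m ⊕ ℕ → ℕ) : ℂ :=
  minorDet (chainMatrix r R n t T) (siteWindow (chainPoints m N) c)

/-! ### Label recursions and time derivative of the entries of `1 - K` -/

section Chain

variable {r R : ℝ} {m : ℕ} {n : Fin m → ℕ} {t : Fin m → ℝ} {N : ℕ} {T : ℝ}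

theorem inl_mem_chainPoints (i : Fin m) : Sum.inl i ∈ chainPoints m N := by
  simp [chainPoints]

theorem inr_mem_chainPoints {j : ℕ} :
    (Sum.inr j : Fin m ⊕ ℕ) ∈ chainPoints m N ↔ 1 ≤ j ∧ j ≤ N := by
  simp [chainPoints]

/-- The `kernelPsi` and rank terms obey the difference relation separately. The identity corrections
account for the change of ordering between the labels `j` and `j + 1`: in column label `j + 1` the
ordering term of row label `j` has difference `kernelPsi r 0 0`, a Kronecker delta. -/
theorem chainMatrix_row_shift (hr : 0 < r) (hr1 : r < 1) (j : ℕ) (u : ℤ)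
    (q : (Fin m ⊕ ℕ) × ℤ) :
    chainMatrix r R n t T (Sum.inr (j + 1), u) q =
      (chainMatrix r R n t T (Sum.inr j, u) q - if (Sum.inr j, u) = q then 1 else 0) -
      (chainMatrix r R n t T (Sum.inr j, u - 1) q -
        if (Sum.inr j, u - 1) = q then 1 else 0) := by
  have h1 : ∀ d t u, kernelPsi r (j + 1 - d) t u =
      kernelPsi r (j - d) t u - kernelPsi r (j - d) t (u - 1) := by
    intro d t u
    rw [← kernelPsi_add_one hr hr1]
    congr 1
    ring
  obtain ⟨b | b, v⟩ := q
  · simp [siteMatrix, kernelRank_label_succ_left hr hr1, h1]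
    ring_nf
  · simp only [siteMatrix, Sum.elim_inr, id, Nat.cast_add, Nat.cast_one,
      kernelRank_label_succ_left hr hr1, h1, Sum.lex_inr_inr, sub_self, Prod.mk.injEq,
      Sum.inr.injEq, gt_iff_lt]
    rcases lt_trichotomy b (j + 1) with h | h | h
    · simp [show ¬ (j < b) by omega, show ¬ (j + 1 < b) by omega, show j + 1 ≠ b by omega]
    · subst h
      have h2 := kernelPsi_add_one hr hr1 (-1) 0 (u - v)
      simp only [Int.reduceNeg, neg_add_cancel, kernelPsi_zero_zero hr] at h2
      simp [sub_eq_zero] at h2 ⊢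
      rw [h2, sub_right_comm]
      ring_nf
    · simp [show (j < b) by omega, show (j + 1 < b) by omega, show j + 1 ≠ b by omega,
        show j ≠ b by omega]
      rw [sub_right_comm u v 1]
      ring_nf

theorem chainMatrix_col_shift (hr : 0 < r) (hr1 : r < 1) (hR : 0 < R) (hR1 : R < 1) (j : ℕ) (u : ℤ)
    (p : (Fin m ⊕ ℕ) × ℤ) :
    chainMatrix r R n t T p (Sum.inr j, u) =
      (chainMatrix r R n t T p (Sum.inr (j + 1), u) -
        if p = (Sum.inr (j + 1), u) then 1 else 0) -
      (chainMatrix r R n t T p (Sum.inr (j + 1), u + 1) -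
        if p = (Sum.inr (j + 1), u + 1) then 1 else 0) := by
  have h1 : ∀ d t u, kernelPsi r (d - j) t u =
      kernelPsi r (d - (j + 1)) t u - kernelPsi r (d - (j + 1)) t (u - 1) := by
    intro d t u
    rw [← kernelPsi_add_one hr hr1]
    congr 1
    ring
  obtain ⟨b | b, v⟩ := p
  · simp [siteMatrix, kernelRank_label_succ_right hR hR1 _ _ _ j]
  · simp only [siteMatrix, Sum.elim_inr, id, Nat.cast_add, Nat.cast_one,
      kernelRank_label_succ_right hR hR1 _ _ _ j, Sum.lex_inr_inr, sub_self, Prod.mk.injEq,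
      Sum.inr.injEq, gt_iff_lt]
    rcases lt_trichotomy b j with h | h | h
    · simp [h, show (b < j + 1) by omega, show b ≠ j by omega, show b ≠ j + 1 by omega, h1]
      rw [← sub_sub]
      ring_nf
    · subst h
      have h2 := kernelPsi_add_one hr hr1 (-1) 0 (v - u)
      simp only [Int.reduceNeg, neg_add_cancel, kernelPsi_zero_zero hr] at h2
      simp [sub_eq_zero] at h2 ⊢
      rw [h2, ← sub_sub]
      ring_nf
    · simp [show ¬ (b < j + 1) by omega, show ¬ b < j by omega, show b ≠ j by omega]

theorem chainMatrix_row_neg (hr : 0 < r) (hr1 : r < 1) (a : Fin m ⊕ ℕ) {u : ℤ} (hu : u < 0)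
    {q : (Fin m ⊕ ℕ) × ℤ} (hq : 0 ≤ q.2) :
    chainMatrix r R n t T (a, u) q = 0 := by
  have h : (a, u) ≠ q := by rintro rfl; exact absurd hq (by simpa using hu)
  simp [siteMatrix, h, kernelRank_of_neg hr hr1 _ _ hu,
    kernelPsi_of_neg hr hr1 _ _ (show u - q.2 < 0 by omega)]

/-- Label `0` is a fictitious particle to the right of all others: it precedes no other point, and
its rank part is an empty sum. It serves as the boundary value of the column recursion. -/
theorem chainMatrix_col_zero (u : ℤ) {p : (Fin m ⊕ ℕ) × ℤ} (hp : p.1 ≠ Sum.inr 0) :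
    chainMatrix r R n t T p (Sum.inr 0, u) = 0 := by
  obtain ⟨b | b, v⟩ := p
  · simp [siteMatrix, kernelRank_label_zero]
  · have : b ≠ 0 := by rintro rfl; exact hp rfl
    simp [siteMatrix, kernelRank_label_zero, this]

/-- Time differentiation shifts the row site down and the column site up. Between two current points
the identity and ordering terms are constant in `T`; they depend on the sites only through their
difference, so their two shifts cancel. -/
theorem hasDerivAt_chainMatrix (hr : 0 < r) (hr1 : r < 1) (hR : 0 < R) (hR1 : R < 1)
    (p q : (Fin m ⊕ ℕ) × ℤ) :
    HasDerivAt (fun T => chainMatrix r R n t T p q)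
      ((if p.1.isRight then chainMatrix r R n t T (p.1, p.2 - 1) q else 0) -
        if q.1.isRight then chainMatrix r R n t T p (q.1, q.2 + 1) else 0) T := by
  obtain ⟨a | a, u⟩ := p <;> obtain ⟨b | b, v⟩ := q
  · simpa [siteMatrix] using hasDerivAt_const _ _
  · have := hasDerivAt_kernelRank_right (r := r) hR hR1 (n a) (t a) u b T v
    simpa [siteMatrix] using this
  · have h1 := hasDerivAt_kernelRank_left (R := R) hr hr1 a T u (n b) (t b) v
    have h2 := (hasDerivAt_kernelPsi hr hr1 (a - n b) (T - t b) (u - v)).comp_sub_const T (t b)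
    have := h2.fun_add h1
    rw [sub_right_comm u v 1] at this
    simpa [siteMatrix] using this
  · have h1 := hasDerivAt_kernelRank hr hr1 hR hR1 a T u b v
    have h2 := h1.const_add
      ((if ((Sum.inr a, u) : (Fin m ⊕ ℕ) × ℤ) = (Sum.inr b, v) then 1 else 0) +
      if a < b then kernelPsi r (a - b) 0 (u - v) else 0)
    refine (h2.congr_deriv ?_).congr_of_eventuallyEq (Filter.Eventually.of_forall fun T => ?_)
    · simp [siteMatrix, sub_eq_iff_eq_add, ← sub_sub, sub_right_comm u 1 v]
      ring_nf
    · simp [siteMatrix]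

end Chain

/-! ### Weakening, evolution, transfer and initial value of the determinants -/

section Chain

variable {r R : ℝ} {m : ℕ} {n : Fin m → ℕ} {t : Fin m → ℝ} {N : ℕ} {T : ℝ}

/-- The row recursion telescopes, with zero boundary term because row `-1` vanishes on nonnegative
columns. -/
theorem sum_range_chainMatrix_row (hr : 0 < r) (hr1 : r < 1) (j : ℕ) (v : ℕ)
    {q : (Fin m ⊕ ℕ) × ℤ} (hq : 0 ≤ q.2) :
    ∑ u ∈ Finset.range (v + 1), chainMatrix r R n t T (Sum.inr (j + 1), (u : ℤ)) q =
      chainMatrix r R n t T (Sum.inr j, (v : ℤ)) q -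
        if (Sum.inr j, (v : ℤ)) = q then 1 else 0 := by
  induction v with
  | zero =>
    have h : (Sum.inr j, (-1 : ℤ)) ≠ q := by rintro rfl; simp at hq
    rw [zero_add, Finset.sum_range_one, chainMatrix_row_shift hr hr1]
    simp only [Nat.cast_zero, zero_sub, chainMatrix_row_neg hr hr1 _ (show (-1 : ℤ) < 0 by simp) hq,
      if_neg h]
    ring
  | succ v ih =>
    rw [Finset.sum_range_succ, ih, chainMatrix_row_shift hr hr1]
    push_cast
    rw [add_sub_cancel_right]
    ring

/-- A constraint implied by the constraint on the next label can be weakened. -/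
theorem chainDet_update_succ_of_le (hr : 0 < r) (hr1 : r < 1) {c : Fin m ⊕ ℕ → ℕ} {j v : ℕ}
    (hj : 1 ≤ j) (hjN : j + 1 ≤ N) (hv : v + 1 ≤ c (Sum.inr (j + 1))) :
    chainDet r R n t N T (Function.update c (Sum.inr j) v) =
      chainDet r R n t N T (Function.update c (Sum.inr j) (v + 1)) := by
  rw [chainDet, ← siteWindow_update_erase]
  have hjj : (Sum.inr (j + 1) : Fin m ⊕ ℕ) ≠ Sum.inr j := by simp
  refine minorDet_erase_eq_of_row (S := (Finset.range (v + 1)).image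
    fun u : ℕ => ((Sum.inr (j + 1) : Fin m ⊕ ℕ), (u : ℤ))) _ ?_ ?_ ?_ ?_
  · simp [mem_siteWindow, inr_mem_chainPoints]
    omega
  · intro p hp
    simp only [Finset.mem_image, Finset.mem_range] at hp
    obtain ⟨u, hu, rfl⟩ := hp
    refine mem_siteWindow.2 ⟨inr_mem_chainPoints.2 (by omega), by simp, ?_⟩
    simp only [Function.update_of_ne hjj]
    omega
  · simp
  · intro q hq
    rw [Finset.sum_image fun a _ b _ h => by simpa using h]
    exact (sum_range_chainMatrix_row hr hr1 j v (mem_siteWindow.1 hq).2.1).symm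

/-- The evolution equation of the determinants in the current time. -/
theorem hasDerivAt_chainDet (hr : 0 < r) (hr1 : r < 1) (hR : 0 < R) (hR1 : R < 1)
    {c : Fin m ⊕ ℕ → ℕ} (hc : ∀ j, 1 ≤ j → j + 1 ≤ N → c (Sum.inr (j + 1)) ≤ c (Sum.inr j)) :
    HasDerivAt (fun T => chainDet r R n t N T c)
      (∑ j ∈ Finset.Icc 1 N,
        (chainDet r R n t N T (Function.update c (Sum.inr j) (c (Sum.inr j) - 1)) -
          chainDet r R n t N T c)) T := by
  set W := siteWindow (chainPoints m N) c with hW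
  set M := chainMatrix r R n t T with hM
  let G₁ : Matrix W W ℂ := Matrix.of fun p q =>
    if p.1.1.isRight then M (p.1.1, p.1.2 - 1) q else 0
  let G₂ : Matrix W W ℂ := Matrix.of fun p q =>
    if q.1.1.isRight then M p (q.1.1, q.1.2 + 1) else 0
  have h := hasDerivAt_det (A := fun T => subMatrix (chainMatrix r R n t T) W) (A' := G₁ - G₂)
    (t := T) fun p q => hasDerivAt_chainMatrix hr hr1 hR hR1 p.1 q.1
  refine h.congr_deriv ?_
  have hsplit : ∀ q : W, ((subMatrix M W).updateCol q fun p => (G₁ - G₂) p q).det =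
      ((subMatrix M W).updateCol q fun p => G₁ p q).det -
        ((subMatrix M W).updateCol q fun p => G₂ p q).det := by
    intro q
    have : (fun p => (G₁ - G₂) p q) = (fun p => G₁ p q) + (-1 : ℂ) • fun p => G₂ p q := by
      ext p; simp [sub_eq_add_neg]
    rw [this, Matrix.det_updateCol_add, Matrix.det_updateCol_smul]
    ring
  rw [Finset.sum_congr rfl fun q _ => hsplit q, Finset.sum_sub_distrib,
    sum_det_updateCol_eq_sum_det_updateRow]
  -- A row shifted down either repeats another row of the window or, at the lowest site, vanishes.
  have hrow : ∀ p : W, ((subMatrix M W).updateRow p (G₁ p)).det = 0 := by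
    rintro ⟨⟨a | a, u⟩, hp⟩
    · exact Matrix.det_eq_zero_of_row_eq_zero ⟨(Sum.inl a, u), hp⟩ fun q => by simp [G₁]
    · have hp' := mem_siteWindow.1 hp
      rcases hp'.2.1.eq_or_lt with h0 | h0
      · refine Matrix.det_eq_zero_of_row_eq_zero ⟨(Sum.inr a, u), hp⟩ fun q => ?_
        simp only at h0
        simp [G₁, ← h0, hM,
          chainMatrix_row_neg hr hr1 _ (show (-1 : ℤ) < 0 by simp) (mem_siteWindow.1 q.2).2.1]
      · have hp2 : (Sum.inr a, u - 1) ∈ W := by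
          simp only at hp' h0
          exact mem_siteWindow.2 ⟨hp'.1, by simp only; omega, by simp only; omega⟩
        have hne : (⟨(Sum.inr a, u), hp⟩ : W) ≠ ⟨(Sum.inr a, u - 1), hp2⟩ := by simp; omega
        refine Matrix.det_zero_of_row_eq hne ?_
        rw [Matrix.updateRow_self, Matrix.updateRow_ne hne.symm]
        ext q
        simp [G₁, subMatrix]
  rw [Finset.sum_eq_zero fun p _ => hrow p, zero_sub]
  -- A column shifted up repeats another column of the window unless it starts at the top site of
  -- its label. Only these top columns contribute.
  have hcol : ∀ q : W, ((subMatrix M W).updateCol q fun p => G₂ p q).det =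
      Sum.elim (fun _ => 0) (fun j => if q.1.2 + 1 = c (Sum.inr j) then
        chainDet r R n t N T c -
          chainDet r R n t N T (Function.update c (Sum.inr j) (c (Sum.inr j) - 1)) else 0)
        q.1.1 := by
    rintro ⟨⟨a | a, u⟩, hq⟩
    · exact Matrix.det_eq_zero_of_column_eq_zero ⟨(Sum.inl a, u), hq⟩ fun q => by simp [G₂]
    · have hq' := mem_siteWindow.1 hq
      simp only at hq'
      simp only [Sum.elim_inr]
      split_ifs with hu
      · obtain ⟨v, hv⟩ : ∃ v : ℕ, c (Sum.inr a) = v + 1 := ⟨c (Sum.inr a) - 1, by omega⟩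
        obtain rfl : u = v := by omega
        have hcu : c = Function.update c (Sum.inr a) (v + 1) := by
          rw [← hv, Function.update_eq_self]
        have he : W.erase (Sum.inr a, (v : ℤ)) =
            siteWindow (chainPoints m N) (Function.update c (Sum.inr a) v) := by
          rw [← siteWindow_update_erase, ← hcu]
        have ha := inr_mem_chainPoints.1 hq'.1
        obtain ⟨b, rfl⟩ : ∃ b, a = b + 1 := ⟨a - 1, by omega⟩
        rw [hv, Nat.add_sub_cancel, chainDet, chainDet, ← he]
        -- The column just above the window is expressed by columns inside it; the identity entry at
        -- that site is absent because the site is outside the window.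
        have hcase : ∀ p : W, M p (Sum.inr (b + 1), (v : ℤ) + 1) =
            M p (Sum.inr (b + 1), (v : ℤ)) - M p (Sum.inr b, (v : ℤ)) -
              if (p : (Fin m ⊕ ℕ) × ℤ) = (Sum.inr (b + 1), (v : ℤ)) then 1 else 0 := by
          intro p
          have hp : (p : (Fin m ⊕ ℕ) × ℤ) ≠ (Sum.inr (b + 1), (v : ℤ) + 1) := by
            intro hp
            have := (mem_siteWindow.1 p.2).2.2
            rw [hp] at this
            simp only [hv] at this
            push_cast at this
            omega
          rw [hM, chainMatrix_col_shift hr hr1 hR hR1 b, if_neg hp]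
          ring
        -- The column with label `b` belongs to the window thanks to the monotonicity `hc`, except
        -- for label `0`, where it is zero.
        by_cases hb : b = 0
        · subst hb
          refine det_updateCol_eq_minorDet_sub M hq (S := ∅) (by simp) (by simp) _ fun p => ?_
          have hp0 : p.1.1 ≠ Sum.inr 0 := by
            intro hp0
            have := (mem_siteWindow.1 p.2).1
            rw [hp0, inr_mem_chainPoints] at this
            omega
          simp only [G₂, Matrix.of_apply, Sum.isRight_inr, if_true, hcase]
          rw [hM, chainMatrix_col_zero _ hp0]
          simp
        · refine det_updateCol_eq_minorDet_sub M hq (S := {(Sum.inr b, (v : ℤ))}) ?_ ?_ _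
            fun p => ?_
          · have := hc b (by omega) ha.2
            rw [Finset.singleton_subset_iff, mem_siteWindow]
            refine ⟨inr_mem_chainPoints.2 (by omega), by simp, ?_⟩
            simp only
            omega
          · simp
          · simp only [G₂, Matrix.of_apply, Sum.isRight_inr, if_true, hcase]
            simp
      · have hq2 : (Sum.inr a, u + 1) ∈ W :=
          mem_siteWindow.2 ⟨hq'.1, by simp only; omega, by simp only; omega⟩
        have hne : (⟨(Sum.inr a, u), hq⟩ : W) ≠ ⟨(Sum.inr a, u + 1), hq2⟩ := by simp
        refine Matrix.det_zero_of_column_eq hne fun p => ?_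
        rw [Matrix.updateCol_self, Matrix.updateCol_ne hne.symm]
        simp [G₂, subMatrix]
  rw [Finset.sum_congr rfl fun q _ => hcol q,
    Finset.sum_coe_sort W (fun q => Sum.elim (fun _ => 0) (fun j =>
      if q.2 + 1 = c (Sum.inr j) then chainDet r R n t N T c -
        chainDet r R n t N T (Function.update c (Sum.inr j) (c (Sum.inr j) - 1)) else 0) q.1),
    hW, sum_siteWindow, chainPoints, Finset.sum_disjSum]
  simp only [Sum.elim_inl, Sum.elim_inr, Finset.sum_const_zero, zero_add]
  rw [← Finset.sum_neg_distrib]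
  refine Finset.sum_congr rfl fun j _ => ?_
  -- Truncated subtraction is harmless: for `c j = 0` lowering changes nothing, and label `j` has no
  -- sites.
  rcases Nat.eq_zero_or_pos (c (Sum.inr j)) with h0 | h0
  · rw [h0, Nat.zero_sub, show Function.update c (Sum.inr j) 0 = c by
      rw [← h0, Function.update_eq_self]]
    simp
  · rw [Finset.sum_eq_single ((c (Sum.inr j) : ℤ) - 1)]
    · simp
    · intro u _ hu
      rw [if_neg (by omega)]
    · intro hu
      simp at hu
      omega

/-- A current constraint that is implied by the constraint at a past point with the same label and
the same time can be weakened. -/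
theorem chainDet_update_inr_of_le (hr : 0 < r) {c : Fin m ⊕ ℕ → ℕ} {k : Fin m}
    (ht : t k = T) (hk : 1 ≤ n k) (hkN : n k ≤ N) (hcl : ∀ i, k < i → c (Sum.inl i) = 0)
    (hcr : ∀ j, n k < j → c (Sum.inr j) = 0) {v : ℕ} (hv : v + 1 ≤ c (Sum.inl k)) :
    chainDet r R n t N T (Function.update c (Sum.inr (n k)) v) =
      chainDet r R n t N T (Function.update c (Sum.inr (n k)) (v + 1)) := by
  rw [chainDet, ← siteWindow_update_erase]
  refine minorDet_erase_eq_of_row (S := {(Sum.inl k, (v : ℤ))}) _ ?_ ?_ ?_ ?_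
  · simp [mem_siteWindow, inr_mem_chainPoints, hk, hkN]
  · rw [Finset.singleton_subset_iff, mem_siteWindow]
    refine ⟨inl_mem_chainPoints k, by simp, ?_⟩
    simp
    omega
  · simp
  -- The two rows have the same label and time, so their rank parts agree. In the columns of `k` the
  -- ordering term of the current row is `kernelPsi r 0 0`, which matches the identity entry of the
  -- past row; `hcl` and `hcr` remove the columns where the orderings would differ.
  · rintro ⟨b | b, u⟩ hq
    · have hb := mem_siteWindow.1 hq
      simp at hb
      have hkb : b ≤ k := by
        by_contra hkb
        have := hcl b (not_le.1 hkb)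
        omega
      rcases hkb.eq_or_lt with rfl | hkb
      · simp [siteMatrix, ht, kernelPsi_zero_zero hr, sub_eq_zero]
      · simp [siteMatrix, ht, hkb, hkb.ne']
    · have hb := mem_siteWindow.1 hq
      simp only at hb
      have hkb : b ≤ n k := by
        by_contra hkb
        have := hcr b (not_le.1 hkb)
        rw [Function.update_of_ne (by simp; omega), this] at hb
        omega
      simp [siteMatrix, ht, hkb.not_gt]

/-- A past constraint that is implied by the constraint at the current point with the same label and
the same time can be weakened. -/
theorem chainDet_update_inl_of_le (hr : 0 < r) {c : Fin m ⊕ ℕ → ℕ} {k : Fin m}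
    (ht : t k = T) (hk : 1 ≤ n k) (hkN : n k ≤ N) (hcl : ∀ i, k < i → c (Sum.inl i) = 0)
    (hcr : ∀ j, n k < j → c (Sum.inr j) = 0) {v : ℕ} (hv : v + 1 ≤ c (Sum.inr (n k))) :
    chainDet r R n t N T (Function.update c (Sum.inl k) v) =
      chainDet r R n t N T (Function.update c (Sum.inl k) (v + 1)) := by
  rw [chainDet, ← siteWindow_update_erase]
  refine minorDet_erase_eq_of_col (S := {(Sum.inr (n k), (v : ℤ))}) _ ?_ ?_ ?_ ?_
  · simp [mem_siteWindow, inl_mem_chainPoints]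
  · rw [Finset.singleton_subset_iff, mem_siteWindow]
    refine ⟨inr_mem_chainPoints.2 ⟨hk, hkN⟩, by simp, ?_⟩
    simp
    omega
  · simp
  · rintro ⟨b | b, u⟩ hq
    · have hb := mem_siteWindow.1 hq
      simp only at hb
      have hkb : b ≤ k := by
        by_contra hkb
        have := hcl b (not_le.1 hkb)
        rw [Function.update_of_ne (by simp; omega), this] at hb
        omega
      simp [siteMatrix, ht, hkb.not_gt]
    · have hb := mem_siteWindow.1 hq
      simp at hb
      have hkb : b ≤ n k := by
        by_contra hkb
        have := hcr b (not_le.1 hkb)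
        omega
      rcases hkb.eq_or_lt with rfl | hkb
      · simp [siteMatrix, ht, kernelPsi_zero_zero hr, sub_eq_zero]
      · simp [siteMatrix, ht, hkb, hkb.ne]

theorem chainDet_update_eq_of_forall {c : Fin m ⊕ ℕ → ℕ} {a : Fin m ⊕ ℕ} {B : ℕ}
    (h : ∀ v, v + 1 ≤ B → chainDet r R n t N T (Function.update c a v) =
      chainDet r R n t N T (Function.update c a (v + 1))) {v : ℕ} (hv : v ≤ B) :
    chainDet r R n t N T (Function.update c a v) =
      chainDet r R n t N T (Function.update c a B) := by
  obtain ⟨d, rfl⟩ := Nat.exists_eq_add_of_le hv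
  induction d with
  | zero => rfl
  | succ d ih =>
    exact (ih (fun w hw => h w (by omega)) (by omega)).trans (h _ le_rfl)

/-- A constraint at a past point can be moved to the current point with the same label and the same
time. -/
theorem chainDet_transfer (hr : 0 < r) {c : Fin m ⊕ ℕ → ℕ} {k : Fin m}
    (ht : t k = T) (hk : 1 ≤ n k) (hkN : n k ≤ N) (hcl : ∀ i, k < i → c (Sum.inl i) = 0)
    (hcr : ∀ j, n k < j → c (Sum.inr j) = 0) :
    chainDet r R n t N T c =
      chainDet r R n t N T (Function.update (Function.update c (Sum.inr (n k))
        (max (c (Sum.inr (n k))) (c (Sum.inl k)))) (Sum.inl k) 0) := by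
  have h1 : chainDet r R n t N T c = chainDet r R n t N T (Function.update c (Sum.inr (n k))
      (max (c (Sum.inr (n k))) (c (Sum.inl k)))) := by
    rcases le_total (c (Sum.inl k)) (c (Sum.inr (n k))) with h | h
    · rw [max_eq_left h, Function.update_eq_self]
    · rw [max_eq_right h, ← chainDet_update_eq_of_forall (fun v hv =>
        chainDet_update_inr_of_le hr ht hk hkN hcl hcr hv) h, Function.update_eq_self]
  set c' := Function.update c (Sum.inr (n k)) (max (c (Sum.inr (n k))) (c (Sum.inl k))) with hc'
  have hk' : c' (Sum.inl k) = c (Sum.inl k) := by simp [hc']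
  have h2 : ∀ v, v + 1 ≤ c' (Sum.inl k) → chainDet r R n t N T (Function.update c' (Sum.inl k) v) =
      chainDet r R n t N T (Function.update c' (Sum.inl k) (v + 1)) := by
    intro v hv
    refine chainDet_update_inl_of_le hr ht hk hkN ?_ ?_ ?_
    · intro i hi; simpa [hc'] using hcl i hi
    · intro j hj; simpa [hc', hj.ne'] using hcr j hj
    · rw [hk'] at hv
      simp only [hc', Function.update_self]
      omega
  rw [h1, chainDet_update_eq_of_forall h2 (Nat.zero_le _), Function.update_eq_self]

/-- Step initial condition: at time `0` no constraint can be satisfied unless it is trivial. -/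
theorem chainDet_zero_eq_zero (hr : 0 < r) (hR : 0 < R) {c : Fin m ⊕ ℕ → ℕ}
    (hcl : ∀ i, c (Sum.inl i) = 0) {j : ℕ} (hj : 1 ≤ j) (hjN : j ≤ N) (hc : 0 < c (Sum.inr j))
    (hcr : ∀ i, j < i → i ≤ N → c (Sum.inr i) = 0) : chainDet r R n t N 0 c = 0 := by
  have hmem : ((Sum.inr j : Fin m ⊕ ℕ), (0 : ℤ)) ∈ siteWindow (chainPoints m N) c := by
    simp [mem_siteWindow, inr_mem_chainPoints, hj, hjN, hc]
  -- In column `(j, 0)` the rank part is `-kernelPsi`. It cancels the identity for label `j` and the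
  -- ordering term for smaller labels; larger labels have no sites.
  refine Matrix.det_eq_zero_of_column_eq_zero ⟨_, hmem⟩ ?_
  rintro ⟨⟨b | b, u⟩, hp⟩
  · have hb := mem_siteWindow.1 hp
    simp [hcl] at hb
    omega
  · have hb := mem_siteWindow.1 hp
    simp [inr_mem_chainPoints] at hb
    have hbj : b ≤ j := by
      by_contra hbj
      have := hcr b (not_le.1 hbj) hb.1.2
      omega
    rcases hbj.eq_or_lt with rfl | hbj
    · simp [subMatrix, siteMatrix, kernelRank_zero_zero hR _ _ hj, kernelPsi_zero_zero hr]
    · simp [subMatrix, siteMatrix, kernelRank_zero_zero hR _ _ hj, hbj, hbj.ne]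

theorem chainDet_eq_one {c : Fin m ⊕ ℕ → ℕ} (hcl : ∀ i, c (Sum.inl i) = 0)
    (hcr : ∀ j, 1 ≤ j → j ≤ N → c (Sum.inr j) = 0) : chainDet r R n t N T c = 1 := by
  have : siteWindow (chainPoints m N) c = ∅ := by
    refine Finset.eq_empty_of_forall_notMem ?_
    rintro ⟨b | b, u⟩ hp
    · have hb := mem_siteWindow.1 hp
      simp [hcl] at hb
      omega
    · have hb := mem_siteWindow.1 hp
      simp [inr_mem_chainPoints] at hb
      have := hcr b hb.1.1 hb.1.2
      omega
  rw [chainDet, this, minorDet, Matrix.det_isEmpty]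

end Chain

/-! ### Power series and the evolution equation -/

theorem summable_expSeries {a : ℕ → ℝ} {C B : ℝ} (ha : ∀ k, |a k| ≤ C * B ^ k) (τ : ℝ) :
    Summable fun k : ℕ => τ ^ k / (k.factorial : ℝ) * a k := by
  refine Summable.of_norm_bounded (((Real.summable_pow_div_factorial (|τ| * B)).mul_left C)) ?_
  intro k
  rw [Real.norm_eq_abs, abs_mul, abs_div, abs_pow, Nat.abs_cast, mul_pow]
  calc |τ| ^ k / (k.factorial : ℝ) * |a k|
      ≤ |τ| ^ k / (k.factorial : ℝ) * (C * B ^ k) := by gcongr; exact ha k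
    _ = C * (|τ| ^ k * B ^ k / (k.factorial : ℝ)) := by ring

theorem hasDerivAt_expSeries {a : ℕ → ℝ} {C B : ℝ} (ha : ∀ k, |a k| ≤ C * B ^ k) (τ : ℝ) :
    HasDerivAt (fun τ : ℝ => ∑' k : ℕ, τ ^ k / (k.factorial : ℝ) * a k)
      (∑' k : ℕ, τ ^ k / (k.factorial : ℝ) * a (k + 1)) τ := by
  have ha' : ∀ k, |a (k + 1)| ≤ (C * B) * B ^ k := fun k => (ha (k + 1)).trans_eq (by ring)
  have hterm : ∀ (k : ℕ) (y : ℝ), HasDerivAt (fun τ : ℝ => τ ^ k / (k.factorial : ℝ) * a k)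
      ((k * y ^ (k - 1)) / (k.factorial : ℝ) * a k) y := fun k y =>
    ((hasDerivAt_pow k y).div_const _).mul_const _
  have hshift : ∀ (k : ℕ) (y : ℝ),
      (((k + 1 : ℕ) : ℝ) * y ^ (k + 1 - 1)) / ((k + 1).factorial : ℝ) * a (k + 1) =
        y ^ k / (k.factorial : ℝ) * a (k + 1) := by
    intro k y
    have := Nat.cast_ne_zero (R := ℝ).2 k.factorial_ne_zero
    rw [Nat.factorial_succ, Nat.add_sub_cancel]
    push_cast
    field_simp
  set ρ := |τ| + 1
  have hρ : 0 ≤ ρ := by positivity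
  let u : ℕ → ℝ := fun k => (k * ρ ^ (k - 1)) / (k.factorial : ℝ) * |a k|
  have hu : Summable u := by
    rw [← summable_nat_add_iff 1]
    have := summable_expSeries (a := fun k => |a (k + 1)|) (by simpa using ha') ρ
    refine this.congr fun k => ?_
    simp only [u]
    have := Nat.cast_ne_zero (R := ℝ).2 k.factorial_ne_zero
    rw [Nat.factorial_succ, Nat.add_sub_cancel]
    push_cast
    field_simp
  -- Termwise differentiation on the ball of radius `|τ| + 1`, where `u` dominates the derivatives.
  have h := hasDerivAt_tsum_of_isPreconnected hu Metric.isOpen_ball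
    (convex_ball (0 : ℝ) ρ).isPreconnected (fun k y _ => hterm k y) (fun k y hy => ?_)
    (Metric.mem_ball_self (by positivity)) (summable_expSeries ha 0)
    (show τ ∈ Metric.ball 0 ρ by simp [ρ])
  · refine h.congr_deriv ?_
    have hs : Summable fun k : ℕ => (k * τ ^ (k - 1)) / (k.factorial : ℝ) * a k := by
      rw [← summable_nat_add_iff 1]
      exact (summable_expSeries ha' τ).congr fun k => (hshift k τ).symm
    rw [hs.tsum_eq_zero_add]
    simp only [Nat.cast_zero, zero_mul, zero_div, zero_add]
    exact tsum_congr fun k => hshift k τ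
  · have : |y| ≤ ρ := by simpa using (Metric.mem_ball.1 hy).le
    rw [Real.norm_eq_abs, abs_mul, abs_div, abs_mul, abs_pow, Nat.abs_cast, Nat.abs_cast]
    simp only [u]
    gcongr

/-- Uniqueness for the evolution equation in which constraints are lowered. -/
theorem eq_zero_of_hasDerivAt_lowering (N : ℕ) {P : (ℕ → ℕ) → Prop}
    (hP : ∀ c, P c → ∀ j ∈ Finset.Icc 1 N, c (j + 1) < c j → P (Function.update c j (c j - 1)))
    {H : (ℕ → ℕ) → ℝ → ℂ} (h0 : ∀ c, P c → H c 0 = 0)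
    (hH : ∀ c, P c → ∀ τ, HasDerivAt (H c) (∑ j ∈ Finset.Icc 1 N, if c (j + 1) < c j then
      H (Function.update c j (c j - 1)) τ - H c τ else 0) τ) (c : ℕ → ℕ) (hc : P c) (τ : ℝ) :
    H c τ = 0 := by
  induction hs : ∑ j ∈ Finset.Icc 1 N, c j using Nat.strong_induction_on generalizing c τ with
  | _ s ih =>
    -- By induction on the total constraint all lowered terms vanish, leaving the scalar equation
    -- `H' = -κ H`, where `κ` counts the admissible lowerings.
    set κ : ℂ := ∑ j ∈ Finset.Icc 1 N, if c (j + 1) < c j then 1 else 0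
    have hd : ∀ τ, HasDerivAt (H c) (-(κ * H c τ)) τ := by
      intro τ
      refine (hH c hc τ).congr_deriv ?_
      rw [Finset.sum_mul, ← Finset.sum_neg_distrib]
      refine Finset.sum_congr rfl fun j hj => ?_
      split_ifs with hlt
      · rw [ih _ ?_ _ (hP c hc j hj hlt) τ rfl]
        · ring
        · rw [← hs]
          refine Finset.sum_lt_sum (fun i _ => ?_) ⟨j, hj, ?_⟩
          · by_cases hij : i = j
            · subst hij; simp
            · simp [hij]
          · simp; omega
      · simp
    have hE : ∀ τ : ℝ, HasDerivAt (fun τ : ℝ => Complex.exp (κ * τ) * H c τ) 0 τ := by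
      intro τ
      have h1 : HasDerivAt (fun τ : ℝ => Complex.exp (κ * τ)) (Complex.exp (κ * τ) * (κ * 1)) τ :=
        ((Complex.ofRealCLM.hasDerivAt (x := τ)).const_mul κ).cexp
      exact (h1.mul (hd τ)).congr_deriv (by ring)
    have hconst := is_const_of_deriv_eq_zero (fun τ => (hE τ).differentiableAt)
      (fun τ => (hE τ).deriv) τ 0
    simp only [h0 c hc, mul_zero] at hconst
    exact (mul_eq_zero.1 hconst).resolve_left (Complex.exp_ne_zero _)

/-! ### The generator on constraint indicators -/

/-- The configurations that TASEP with step initial condition can reach. -/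
def stepStates : Set (ℕ+ → ℤ) := {x | StrictAnti x ∧ ∀ n : ℕ+, -((n : ℕ) : ℤ) ≤ x n}

theorem update_mem_stepStates {x : ℕ+ → ℤ} (hx : x ∈ stepStates) {n : ℕ+}
    (hn : ∀ j, x j ≠ x n + 1) : Function.update x n (x n + 1) ∈ stepStates := by
  refine ⟨fun a b hab => ?_, fun k => ?_⟩
  · have h := hx.1 hab
    by_cases ha : a = n
    · subst ha
      rw [Function.update_self, Function.update_of_ne hab.ne']
      omega
    · by_cases hb : b = n
      · subst hb
        rw [Function.update_self, Function.update_of_ne hab.ne]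
        have := hn a
        omega
      · rwa [Function.update_of_ne ha, Function.update_of_ne hb]
  · have h := hx.2 k
    by_cases hk : k = n
    · subst hk
      rw [Function.update_self]
      omega
    · rwa [Function.update_of_ne hk]

theorem tasepGenerator_congr {f g : (ℕ+ → ℤ) → ℝ} (h : ∀ x ∈ stepStates, f x = g x)
    {x : ℕ+ → ℤ} (hx : x ∈ stepStates) : tasepGenerator f x = tasepGenerator g x := by
  unfold tasepGenerator
  refine tsum_congr fun n => ?_
  split_ifs with hn
  · rw [h x hx, h _ (update_mem_stepStates hx hn)]
  · rfl

/-- The labels `1, …, N`. -/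
def firstLabels (N : ℕ) : Finset ℕ+ := (Finset.range N).map ⟨Nat.succPNat, Nat.succPNat_injective⟩

theorem mem_firstLabels {N : ℕ} {n : ℕ+} : n ∈ firstLabels N ↔ (n : ℕ) ≤ N := by
  simp only [firstLabels, Finset.mem_map, Finset.mem_range, Function.Embedding.coeFn_mk]
  constructor
  · rintro ⟨k, hk, rfl⟩
    simpa using hk
  · intro h
    exact ⟨n.natPred, by have := n.natPred_add_one; omega, PNat.succPNat_natPred n⟩

theorem sum_firstLabels (N : ℕ) (f : ℕ → ℝ) :
    ∑ n ∈ firstLabels N, f n = ∑ j ∈ Finset.Icc 1 N, f j := by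
  rw [firstLabels, Finset.sum_map]
  simp only [Function.Embedding.coeFn_mk, Nat.succPNat_coe, Nat.succ_eq_add_one]
  rw [Finset.range_eq_Ico, Finset.sum_Ico_add' f 0 N 1]
  rfl

open Classical in
theorem tasepGenerator_eq_sum {N : ℕ} {f : (ℕ+ → ℤ) → ℝ}
    (hf : DependsOn f (firstLabels N : Set ℕ+)) (x : ℕ+ → ℤ) :
    tasepGenerator f x = ∑ n ∈ firstLabels N,
      if ∀ j, x j ≠ x n + 1 then f (Function.update x n (x n + 1)) - f x else 0 := by
  unfold tasepGenerator
  refine tsum_eq_sum fun n hn => ?_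
  split_ifs
  · rw [sub_eq_zero]
    refine hf fun i hi => ?_
    rw [Function.update_of_ne]
    rintro rfl
    exact hn hi
  · rfl

open Classical in
/-- The indicator that the particles with labels `n ≤ N` are at or to the right of `c n - n`. -/
noncomputable def constraintInd (N : ℕ) (c : ℕ → ℕ) (x : ℕ+ → ℤ) : ℝ :=
  if ∀ n : ℕ+, (n : ℕ) ≤ N → (c n : ℤ) ≤ x n + (n : ℕ) then 1 else 0

/-- The iterates of the generator on `constraintInd N c`. -/
noncomputable def constraintIter (N : ℕ) : ℕ → (ℕ → ℕ) → (ℕ+ → ℤ) → ℝ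
  | 0, c, x => constraintInd N c x
  | k + 1, c, x => ∑ j ∈ Finset.Icc 1 N, if c (j + 1) < c j then
      constraintIter N k (Function.update c j (c j - 1)) x - constraintIter N k c x else 0

theorem dependsOn_constraintIter (N k : ℕ) (c : ℕ → ℕ) :
    DependsOn (constraintIter N k c) (firstLabels N : Set ℕ+) := by
  induction k generalizing c with
  | zero =>
    intro x y h
    simp only [constraintIter, constraintInd]
    congr 1
    refine propext (forall_congr' fun n => forall_congr' fun hn => ?_)
    rw [h n (mem_firstLabels.2 hn)]
  | succ k ih =>
    intro x y h
    simp only [constraintIter]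
    refine Finset.sum_congr rfl fun j _ => ?_
    rw [ih _ h, ih _ h]

theorem measurable_constraintIter (N k : ℕ) (c : ℕ → ℕ) : Measurable (constraintIter N k c) := by
  induction k generalizing c with
  | zero =>
    classical
    refine Measurable.ite ?_ measurable_const measurable_const
    rw [Set.ofPred_forall]
    refine MeasurableSet.iInter fun n => ?_
    rw [Set.ofPred_forall]
    refine MeasurableSet.iInter fun _ => ?_
    exact measurableSet_le measurable_const ((measurable_pi_apply n).add measurable_const)
  | succ k ih =>
    refine Finset.measurable_fun_sum _ fun j _ => ?_
    split_ifs
    · exact (ih _).sub (ih _)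
    · exact measurable_const

theorem abs_constraintIter_le (N k : ℕ) (c : ℕ → ℕ) (x : ℕ+ → ℤ) :
    |constraintIter N k c x| ≤ (2 * N : ℝ) ^ k := by
  induction k generalizing c with
  | zero =>
    simp only [constraintIter, constraintInd]
    split_ifs <;> simp
  | succ k ih =>
    simp only [constraintIter]
    calc _ ≤ ∑ j ∈ Finset.Icc 1 N, (2 * (2 * N : ℝ) ^ k) := by
          refine (Finset.abs_sum_le_sum_abs _ _).trans (Finset.sum_le_sum fun j _ => ?_)
          split_ifs
          · refine (abs_sub _ _).trans ?_
            have := ih c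
            have := ih (Function.update c j (c j - 1))
            linarith
          · simp only [abs_zero]
            positivity
      _ = (2 * N : ℝ) ^ (k + 1) := by
          rw [Finset.sum_const, Nat.card_Icc, nsmul_eq_mul]
          simp only [Nat.add_sub_cancel]
          ring

/-- The weakly decreasing constraints on the labels `1, …, N`. -/
def IsConstraint (N : ℕ) (c : ℕ → ℕ) : Prop :=
  (∀ j, N < j → c j = 0) ∧ ∀ j, 1 ≤ j → c (j + 1) ≤ c j

theorem IsConstraint.update {N : ℕ} {c : ℕ → ℕ} (hc : IsConstraint N c) {j : ℕ}
    (hlt : c (j + 1) < c j) : IsConstraint N (Function.update c j (c j - 1)) := by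
  refine ⟨fun i hi => ?_, fun i hi => ?_⟩
  · by_cases h : i = j
    · subst h; simp [hc.1 i hi]
    · simp [h, hc.1 i hi]
  · have := hc.2 i hi
    by_cases h : i = j
    · subst h
      simp
      omega
    · by_cases h' : i + 1 = j
      · subst h'
        simp
        omega
      · simp [h, h', this]

theorem IsConstraint.le_of_le {N : ℕ} {c : ℕ → ℕ} (hc : IsConstraint N c) {i j : ℕ} (hi : 1 ≤ i)
    (hij : i ≤ j) : c j ≤ c i := by
  induction j, hij using Nat.le_induction with
  | base => rfl
  | succ k hk ih => exact (hc.2 k (hi.trans hk)).trans ih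

/-- Moving particle `n` to the right amounts to lowering its constraint. The two conditions may
differ, but then the difference they multiply is zero: on a plateau of `c` exclusion from particle
`n + 1` makes the lowering redundant, and a blocked particle inherits its constraint from the
particle in front of it. -/
theorem tasepGenerator_constraintInd {N : ℕ} {c : ℕ → ℕ} (hc : IsConstraint N c) {x : ℕ+ → ℤ}
    (hx : x ∈ stepStates) {n : ℕ+} (hn : (n : ℕ) ≤ N) [Decidable (∀ j, x j ≠ x n + 1)] :
    (if ∀ j, x j ≠ x n + 1 then
      constraintInd N c (Function.update x n (x n + 1)) - constraintInd N c x else 0) =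
    if c (n + 1) < c n then
      constraintInd N (Function.update c n (c n - 1)) x - constraintInd N c x else 0 := by
  have hx1 := hx.2 n
  split_ifs with h1 h2 h2
  · congr 1
    simp only [constraintInd]
    congr 1
    refine propext (forall_congr' fun k => forall_congr' fun _ => ?_)
    by_cases hk : k = n
    · subst hk
      simp only [Function.update_self]
      omega
    · rw [Function.update_of_ne hk, Function.update_of_ne (by simpa using hk)]
  -- Plateau: if only the moved particle met the bound, particle `n + 1` would have to lie strictly
  -- behind it and still meet an equal constraint, which is impossible.
  · rw [sub_eq_zero]
    simp only [constraintInd]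
    congr 1
    refine propext ⟨fun H k hk => ?_, fun H k hk => ?_⟩
    · by_cases hkn : k = n
      · subst hkn
        have H1 := H k hk
        rw [Function.update_self] at H1
        by_contra H2
        have hcn := hc.2 k k.pos
        have hN : (k : ℕ) + 1 ≤ N := by
          by_contra hN
          have := hc.1 (k + 1) (by omega)
          omega
        have H3 := H (k + 1) (by simpa using hN)
        have hlt : k < k + 1 := PNat.lt_add_right k 1
        rw [Function.update_of_ne hlt.ne'] at H3
        have H4 := hx.1 hlt
        simp only [PNat.add_coe, PNat.one_coe] at H3
        push_cast at H3
        omega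
      · have := H k hk
        rwa [Function.update_of_ne hkn] at this
    · have H1 := H k hk
      by_cases hkn : k = n
      · subst hkn
        rw [Function.update_self]
        omega
      · rwa [Function.update_of_ne hkn]
  -- Blocked: the site ahead is held by a particle `i < n`, whose constraint is at least as strong
  -- and already implies that of `n`.
  · rw [eq_comm, sub_eq_zero]
    simp only [constraintInd]
    congr 1
    push Not at h1
    obtain ⟨i, hi⟩ := h1
    have hin : i < n := by
      rw [← hx.1.lt_iff_gt]
      omega
    refine propext ⟨fun H k hk => ?_, fun H k hk => ?_⟩
    · have H1 := H k hk
      by_cases hkn : k = n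
      · subst hkn
        rw [Function.update_self] at H1
        have hik : (i : ℕ) < k := hin
        have H2 := H i (by omega)
        rw [Function.update_of_ne hik.ne] at H2
        have H3 := hc.le_of_le i.pos hik.le
        omega
      · rwa [Function.update_of_ne (by simpa using hkn)] at H1
    · have H1 := H k hk
      by_cases hkn : k = n
      · subst hkn
        rw [Function.update_self]
        omega
      · rwa [Function.update_of_ne (by simpa using hkn)]
  · rfl

/-- The generator moves particles while the recursion lowers constraints. These two linear
operations commute, so the induction only interchanges two finite sums. -/
theorem tasepGenerator_constraintIter {N : ℕ} (k : ℕ) {c : ℕ → ℕ} (hc : IsConstraint N c)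
    {x : ℕ+ → ℤ} (hx : x ∈ stepStates) :
    tasepGenerator (constraintIter N k c) x = constraintIter N (k + 1) c x := by
  classical
  induction k generalizing c with
  | zero =>
    rw [tasepGenerator_eq_sum (dependsOn_constraintIter N 0 c)]
    simp only [constraintIter]
    rw [← sum_firstLabels N fun j => if c (j + 1) < c j then
      constraintInd N (Function.update c j (c j - 1)) x - constraintInd N c x else 0]
    exact Finset.sum_congr rfl fun n hn =>
      tasepGenerator_constraintInd hc hx (mem_firstLabels.1 hn)
  | succ k ih =>
    rw [tasepGenerator_eq_sum (dependsOn_constraintIter N (k + 1) c)]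
    conv_rhs => rw [constraintIter]
    have h1 : ∀ j ∈ Finset.Icc 1 N, (if c (j + 1) < c j then
        constraintIter N (k + 1) (Function.update c j (c j - 1)) x -
          constraintIter N (k + 1) c x else 0) = ∑ n ∈ firstLabels N, if c (j + 1) < c j then
        ((if ∀ i, x i ≠ x n + 1 then
          constraintIter N k (Function.update c j (c j - 1)) (Function.update x n (x n + 1)) -
            constraintIter N k (Function.update c j (c j - 1)) x else 0) -
          (if ∀ i, x i ≠ x n + 1 then constraintIter N k c (Function.update x n (x n + 1)) -
            constraintIter N k c x else 0)) else 0 := by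
      intro j _
      split_ifs with hlt
      · rw [← ih hc, ← ih (hc.update hlt), tasepGenerator_eq_sum (dependsOn_constraintIter N k _),
          tasepGenerator_eq_sum (dependsOn_constraintIter N k _), ← Finset.sum_sub_distrib]
      · simp
    rw [Finset.sum_congr rfl h1, Finset.sum_comm]
    refine Finset.sum_congr rfl fun n _ => ?_
    simp only [constraintIter]
    split_ifs with hn
    · rw [← Finset.sum_sub_distrib]
      refine Finset.sum_congr rfl fun j _ => ?_
      split_ifs <;> ring
    · simp

theorem iterate_tasepGenerator_constraintInd {N : ℕ} (k : ℕ) {c : ℕ → ℕ} (hc : IsConstraint N c)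
    {x : ℕ+ → ℤ} (hx : x ∈ stepStates) :
    tasepGenerator^[k] (constraintInd N c) x = constraintIter N k c x := by
  induction k generalizing x with
  | zero => rfl
  | succ k ih =>
    rw [Function.iterate_succ_apply', tasepGenerator_congr (fun y hy => ih hy) hx,
      tasepGenerator_constraintIter k hc hx]

theorem tasepSemigroup_constraintInd {N : ℕ} {c : ℕ → ℕ} (hc : IsConstraint N c) (τ : ℝ≥0)
    {x : ℕ+ → ℤ} (hx : x ∈ stepStates) :
    tasepSemigroup τ (constraintInd N c) x =
      ∑' k : ℕ, ((τ : ℝ) ^ k / (k.factorial : ℝ)) * constraintIter N k c x :=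
  tsum_congr fun k => by rw [iterate_tasepGenerator_constraintInd k hc hx]

/-! ### The process -/

section StepProcess

variable {Ω : Type*} [MeasurableSpace Ω] {μ : Measure Ω} {X : ℝ≥0 → Ω → (ℕ+ → ℤ)}

theorem measurable_tasepPast {Ω : Type*} {X : ℝ≥0 → Ω → (ℕ+ → ℤ)} {r s : ℝ≥0} (hrs : r ≤ s) :
    @Measurable _ _ (tasepPast X s) _ (X r) :=
  measurable_iff_comap_le.2 (le_iSup₂_of_le r hrs le_rfl)

theorem IsStepTASEP.tasepPast_le (hX : IsStepTASEP μ X) (s : ℝ≥0) :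
    tasepPast X s ≤ ‹MeasurableSpace Ω› :=
  iSup_le fun r => iSup_le fun _ => (hX.measurable r).comap_le

theorem IsStepTASEP.setIntegral_markov [IsProbabilityMeasure μ] (hX : IsStepTASEP μ X) (s τ : ℝ≥0)
    {f : (ℕ+ → ℤ) → ℝ}
    (hf : ∃ S : Finset ℕ+, DependsOn f (S : Set ℕ+)) {C : ℝ} (hC : ∀ x, |f x| ≤ C)
    (hfm : Measurable f) {A : Set Ω} (hA : MeasurableSet[tasepPast X s] A) :
    ∫ ω in A, f (X (s + τ) ω) ∂μ = ∫ ω in A, tasepSemigroup τ f (X s ω) ∂μ := by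
  have hle := hX.tasepPast_le s
  have hint : Integrable (fun ω => f (X (s + τ) ω)) μ :=
    Integrable.of_bound (hfm.comp (hX.measurable _)).aestronglyMeasurable C
      (Filter.Eventually.of_forall fun ω => hC _)
  rw [← setIntegral_condExp hle hint hA]
  exact setIntegral_congr_ae (hle _ hA) ((hX.markov s τ f hf ⟨C, hC⟩).mono fun ω h _ => h)

theorem IsStepTASEP.ae_initial_mem (hX : IsStepTASEP μ X) : ∀ᵐ ω ∂μ, X 0 ω ∈ stepStates := by
  filter_upwards [hX.initial, hX.ordered 0] with ω h1 h2
  exact ⟨h2, fun n => (h1 n).ge⟩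

/-- The indicator of `-n ≤ x n` is identically `1` on the reachable states, so the generator kills
it there and the semigroup leaves its expectation at `1`. -/
theorem IsStepTASEP.ae_mem_stepStates [IsProbabilityMeasure μ] (hX : IsStepTASEP μ X) (T : ℝ≥0) :
    ∀ᵐ ω ∂μ, X T ω ∈ stepStates := by
  suffices h : ∀ n : ℕ+, ∀ᵐ ω ∂μ, -((n : ℕ) : ℤ) ≤ X T ω n by
    filter_upwards [hX.ordered T, ae_all_iff.2 h] with ω h1 h2 using ⟨h1, h2⟩
  intro n
  classical
  let f : (ℕ+ → ℤ) → ℝ := fun x => if -((n : ℕ) : ℤ) ≤ x n then 1 else 0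
  have hfm : Measurable f :=
    Measurable.ite (measurableSet_le measurable_const (measurable_pi_apply n)) measurable_const
      measurable_const
  have hfC : ∀ x, |f x| ≤ 1 := fun x => by simp only [f]; split_ifs <;> simp
  have hf1 : ∀ x ∈ stepStates, f x = 1 := fun x hx => if_pos (hx.2 n)
  have hL : ∀ k, ∀ x ∈ stepStates, tasepGenerator^[k + 1] f x = 0 := by
    have h0 : ∀ x, tasepGenerator (fun _ => 0) x = 0 := fun x => by simp [tasepGenerator]
    intro k
    induction k with
    | zero =>
      intro x hx
      rw [zero_add, Function.iterate_one, tasepGenerator_congr (g := fun _ => 1) hf1 hx]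
      simp [tasepGenerator]
    | succ k ih =>
      intro x hx
      rw [Function.iterate_succ_apply', tasepGenerator_congr (g := fun _ => 0) ih hx, h0]
  have hsg : ∀ x ∈ stepStates, tasepSemigroup T f x = 1 := by
    intro x hx
    rw [tasepSemigroup, tsum_eq_single 0]
    · simp [hf1 x hx]
    · intro k hk
      obtain ⟨k, rfl⟩ := Nat.exists_eq_succ_of_ne_zero hk
      rw [hL k x hx, mul_zero]
  have h := hX.setIntegral_markov 0 T (f := f) ⟨{n}, fun x y hxy => by
    simp only [f]; rw [hxy n (by simp)]⟩ hfC hfm (A := Set.univ) MeasurableSet.univ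
  rw [zero_add, setIntegral_univ, setIntegral_univ, integral_congr_ae (g := fun _ => (1 : ℝ))
    (hX.ae_initial_mem.mono fun ω hω => hsg _ hω)] at h
  have hms : MeasurableSet {ω | -((n : ℕ) : ℤ) ≤ X T ω n} :=
    measurableSet_le measurable_const ((measurable_pi_apply n).comp (hX.measurable T))
  have h2 : (fun ω => f (X T ω)) = Set.indicator {ω | -((n : ℕ) : ℤ) ≤ X T ω n} fun _ => 1 := by
    ext ω
    simp [f, Set.indicator_apply]
  rw [h2, integral_indicator_const _ hms] at h
  simp only [integral_const, probReal_univ, smul_eq_mul, mul_one] at h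
  rw [Measure.real, ENNReal.toReal_eq_one_iff] at h
  exact (mem_ae_iff_prob_eq_one hms).2 h

/-- The event that all constraints hold at time `T`. -/
def constraintSet (X : ℝ≥0 → Ω → (ℕ+ → ℤ)) (N : ℕ) (T : ℝ≥0) (c : ℕ → ℕ) : Set Ω :=
  {ω | ∀ n : ℕ+, (n : ℕ) ≤ N → (c n : ℤ) ≤ X T ω n + (n : ℕ)}

theorem IsStepTASEP.measurableSet_constraintSet (hX : IsStepTASEP μ X) (N : ℕ) (T : ℝ≥0)
    (c : ℕ → ℕ) : MeasurableSet (constraintSet X N T c) := by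
  rw [constraintSet, Set.ofPred_forall]
  refine MeasurableSet.iInter fun n => ?_
  rw [Set.ofPred_forall]
  refine MeasurableSet.iInter fun _ => ?_
  exact measurableSet_le measurable_const
    (((measurable_pi_apply n).comp (hX.measurable T)).add measurable_const)

theorem IsStepTASEP.measureReal_inter_constraintSet [IsProbabilityMeasure μ] (hX : IsStepTASEP μ X) (N : ℕ)
    (T : ℝ≥0)
    (c : ℕ → ℕ) (A : Set Ω) :
    μ.real (A ∩ constraintSet X N T c) = ∫ ω in A, constraintIter N 0 c (X T ω) ∂μ := by
  have hms := hX.measurableSet_constraintSet N T c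
  have h2 : (fun ω => constraintIter N 0 c (X T ω)) =
      Set.indicator (constraintSet X N T c) fun _ => 1 := by
    ext ω
    classical
    rw [Set.indicator_apply]
    simp only [constraintIter, constraintInd, constraintSet]
    congr
  rw [h2, integral_indicator_const _ hms, measureReal_restrict_apply hms, smul_eq_mul, mul_one,
    Set.inter_comm]

/-- The semigroup series is integrated term by term; the bound `(2 * N) ^ k` on the iterates
justifies the interchange. -/
theorem IsStepTASEP.measureReal_inter_constraintSet_add [IsProbabilityMeasure μ] (hX : IsStepTASEP μ X) {N : ℕ}
    (s τ : ℝ≥0)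
    {c : ℕ → ℕ} (hc : IsConstraint N c) {A : Set Ω} (hA : MeasurableSet[tasepPast X s] A) :
    μ.real (A ∩ constraintSet X N (s + τ) c) =
      ∑' k : ℕ, ((τ : ℝ) ^ k / (k.factorial : ℝ)) * ∫ ω in A, constraintIter N k c (X s ω) ∂μ := by
  have hle := hX.tasepPast_le s
  have hmeas : ∀ k, AEStronglyMeasurable (fun ω => constraintIter N k c (X s ω)) (μ.restrict A) :=
    fun k => ((measurable_constraintIter N k c).comp (hX.measurable s)).aestronglyMeasurable
  have hint : ∀ k, Integrable (fun ω => constraintIter N k c (X s ω)) (μ.restrict A) := fun k =>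
    Integrable.of_bound (hmeas k) _
      (Filter.Eventually.of_forall fun ω => abs_constraintIter_le N k c _)
  rw [hX.measureReal_inter_constraintSet, hX.setIntegral_markov s τ
    ⟨_, dependsOn_constraintIter N 0 c⟩ (abs_constraintIter_le N 0 c)
    (measurable_constraintIter N 0 c) hA]
  change ∫ ω in A, tasepSemigroup τ (constraintInd N c) (X s ω) ∂μ = _
  rw [setIntegral_congr_ae (hle _ hA) ((hX.ae_mem_stepStates s).mono fun ω hω _ =>
      tasepSemigroup_constraintInd hc τ hω),
    ← integral_tsum_of_summable_integral_norm]
  · exact tsum_congr fun k => integral_const_mul _ _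
  · exact fun k => (hint k).const_mul _
  · have hb : ∀ k, |∫ ω in A, ‖constraintIter N k c (X s ω)‖ ∂μ| ≤ 1 * (2 * N : ℝ) ^ k := by
      intro k
      rw [abs_of_nonneg (integral_nonneg fun ω => norm_nonneg _), one_mul]
      refine (integral_mono (hint k).norm (integrable_const ((2 * N : ℝ) ^ k))
        fun ω => abs_constraintIter_le N k c _).trans ?_
      rw [integral_const, smul_eq_mul]
      refine mul_le_of_le_one_left (by positivity) ?_
      rw [measureReal_restrict_apply_univ]
      exact measureReal_le_one
    refine (summable_expSeries hb τ).congr fun k => ?_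
    simp_rw [norm_mul]
    rw [integral_const_mul, Real.norm_of_nonneg (by positivity)]

end StepProcess

/-! ### Joint laws of the process as determinants -/

section Chain

variable {Ω : Type*} [MeasurableSpace Ω] {μ : Measure Ω} {X : ℝ≥0 → Ω → (ℕ+ → ℤ)}
  {m : ℕ} {n : Fin m → ℕ+} {t : Fin m → ℝ≥0} {N : ℕ} {r R : ℝ}

/-- The event that the nontrivial constraints at the past points hold. -/
def pastSet (X : ℝ≥0 → Ω → (ℕ+ → ℤ)) (n : Fin m → ℕ+) (t : Fin m → ℝ≥0) (d : Fin m → ℕ) : Set Ω :=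
  {ω | ∀ i, 0 < d i → (d i : ℤ) ≤ X (t i) ω (n i) + (n i : ℕ)}

/-- Trivial constraints do not enter `pastSet`, so points with times beyond `s` do no harm as long
as they are unconstrained. -/
theorem measurableSet_pastSet {Ω : Type*} {X : ℝ≥0 → Ω → (ℕ+ → ℤ)} {s : ℝ≥0} {d : Fin m → ℕ}
    (hd : ∀ i, 0 < d i → t i ≤ s) :
    MeasurableSet[tasepPast X s] (pastSet X n t d) := by
  rw [pastSet, Set.ofPred_forall]
  refine MeasurableSet.iInter fun i => ?_
  rw [Set.ofPred_forall]
  refine MeasurableSet.iInter fun hi => ?_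
  have h1 : Measurable fun x : ℕ+ → ℤ => x (n i) + ((n i : ℕ) : ℤ) :=
    (measurable_pi_apply (n i)).add measurable_const
  exact (h1.comp (measurable_tasepPast (hd i hi)))
    (measurableSet_Ici : MeasurableSet (Set.Ici (d i : ℤ)))

/-- The joint distribution at past points and at time `T` is given by the determinant. -/
def HasChainDet (μ : Measure Ω) (X : ℝ≥0 → Ω → (ℕ+ → ℤ)) (r R : ℝ) (n : Fin m → ℕ+)
    (t : Fin m → ℝ≥0) (N : ℕ) (T : ℝ≥0) (d : Fin m → ℕ) (c : ℕ → ℕ) : Prop :=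
  ((μ.real (pastSet X n t d ∩ constraintSet X N T c) : ℝ) : ℂ) =
    chainDet r R (fun i => (n i : ℕ)) (fun i => (t i : ℝ)) N T (Sum.elim d c)

/-- It suffices to consider constraints that are weakly decreasing in the label. -/
theorem hasChainDet_of_antitone [IsProbabilityMeasure μ] (hX : IsStepTASEP μ X) (hr : 0 < r)
    (hr1 : r < 1) {T : ℝ≥0} {d : Fin m → ℕ} {ν : ℕ} (hν : ν ≤ N)
    (h : ∀ c : ℕ → ℕ, (∀ j, ν < j → c j = 0) → IsConstraint N c → HasChainDet μ X r R n t N T d c)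
    {c : ℕ → ℕ} (hc : ∀ j, ν < j → c j = 0) : HasChainDet μ X r R n t N T d c := by
  -- Violations of monotonicity are repaired by raising `c j` by one; with an upper bound `B` the
  -- sum of `B - c j` decreases, so this terminates. Neither the determinant nor, by strict ordering
  -- of the particles, the probability changes.
  obtain ⟨B, hB⟩ : ∃ B, ∀ j, 1 ≤ j → c j ≤ B := by
    refine ⟨∑ j ∈ Finset.Icc 1 N, c j, fun j hj => ?_⟩
    by_cases hjN : j ≤ N
    · exact Finset.single_le_sum (f := c) (fun _ _ => Nat.zero_le _) (Finset.mem_Icc.2 ⟨hj, hjN⟩)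
    · simp [hc j (by omega)]
  induction hs : ∑ j ∈ Finset.Icc 1 N, (B - c j) using Nat.strong_induction_on generalizing c with
  | _ s ih =>
    by_cases hanti : ∀ j, 1 ≤ j → c (j + 1) ≤ c j
    · exact h c hc ⟨fun j hj => hc j (by omega), hanti⟩
    push Not at hanti
    obtain ⟨j, hj, hlt⟩ := hanti
    have hjν : j + 1 ≤ ν := by
      by_contra hjν
      have := hc (j + 1) (by omega)
      omega
    have hBj := hB (j + 1) (by omega)
    have key := ih _ ?_ (c := Function.update c j (c j + 1)) ?_ ?_ rfl
    · unfold HasChainDet at key ⊢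
      have hdet := chainDet_update_succ_of_le (R := R) (n := fun i => (n i : ℕ))
        (t := fun i => (t i : ℝ)) (T := T) hr hr1 (c := Sum.elim d c) (v := c j) hj (hjν.trans hν)
        (by simpa using hlt)
      rw [Sum.update_elim_inr, Sum.update_elim_inr, Function.update_eq_self] at hdet
      rw [hdet, ← key]
      congr 1
      refine measureReal_congr ?_
      filter_upwards [hX.ae_mem_stepStates T] with ω hω
      refine propext (and_congr_right fun _ => ⟨fun H k hk => ?_, fun H k hk => ?_⟩)
      · by_cases hkj : (k : ℕ) = j
        · rw [← hkj, Function.update_self]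
          have h1 := H (k + 1) (by simp only [PNat.add_coe, PNat.one_coe]; omega)
          have h2 := hω.1 (PNat.lt_add_right k 1)
          simp only [PNat.add_coe, PNat.one_coe, hkj] at h1
          rw [← hkj] at h1 hlt
          push_cast at h1 ⊢
          omega
        · rw [Function.update_of_ne hkj]
          exact H k hk
      · have h1 := H k hk
        by_cases hkj : (k : ℕ) = j
        · rw [← hkj, Function.update_self] at h1
          push_cast at h1
          omega
        · rwa [Function.update_of_ne hkj] at h1
    · rw [← hs]
      refine Finset.sum_lt_sum (fun i _ => ?_) ⟨j, Finset.mem_Icc.2 ⟨hj, by omega⟩, ?_⟩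
      · by_cases hij : i = j
        · subst hij; simp; omega
        · simp [hij]
      · simp; omega
    · intro i hi
      rw [Function.update_of_ne (by omega)]
      exact hc i hi
    · intro i hi
      by_cases hij : i = j
      · subst hij; simp; omega
      · simpa [hij] using hB i hi

/-- The identity propagates in the current time. -/
theorem hasChainDet_add [IsProbabilityMeasure μ] (hX : IsStepTASEP μ X) (hr : 0 < r) (hr1 : r < 1)
    (hR : 0 < R) (hR1 : R < 1) {s : ℝ≥0} {d : Fin m → ℕ} {ν : ℕ}
    (hd : ∀ i, 0 < d i → t i ≤ s)
    (h : ∀ c : ℕ → ℕ, (∀ j, ν < j → c j = 0) → IsConstraint N c → HasChainDet μ X r R n t N s d c)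
    (τ : ℝ≥0) {c : ℕ → ℕ} (hcν : ∀ j, ν < j → c j = 0) (hc : IsConstraint N c) :
    HasChainDet μ X r R n t N (s + τ) d c := by
  have hA := measurableSet_pastSet (X := X) (n := n) hd
  set A := pastSet X n t d
  let a : (ℕ → ℕ) → ℕ → ℝ := fun c k => ∫ ω in A, constraintIter N k c (X s ω) ∂μ
  have hint : ∀ c k, Integrable (fun ω => constraintIter N k c (X s ω)) (μ.restrict A) :=
    fun c k => Integrable.of_bound
      ((measurable_constraintIter N k c).comp (hX.measurable s)).aestronglyMeasurable _
      (Filter.Eventually.of_forall fun ω => abs_constraintIter_le N k c _)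
  have ha : ∀ c k, |a c k| ≤ 1 * (2 * N : ℝ) ^ k := by
    intro c k
    refine (norm_integral_le_of_norm_le_const (f := fun ω => constraintIter N k c (X s ω))
      (C := (2 * N : ℝ) ^ k) (Filter.Eventually.of_forall fun ω =>
      abs_constraintIter_le N k c (X s ω))).trans ?_
    rw [mul_comm]
    gcongr
    rw [measureReal_restrict_apply_univ]
    exact measureReal_le_one
  -- The probabilities are extended to all real `τ` by their power series, which avoids one-sided
  -- derivatives at `0`.
  let F : (ℕ → ℕ) → ℝ → ℝ := fun c τ => ∑' k : ℕ, τ ^ k / (k.factorial : ℝ) * a c k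
  have hF : ∀ c τ, HasDerivAt (F c) (∑ j ∈ Finset.Icc 1 N, if c (j + 1) < c j then
      F (Function.update c j (c j - 1)) τ - F c τ else 0) τ := by
    intro c τ
    refine (hasDerivAt_expSeries (ha c) τ).congr_deriv ?_
    have ha1 : ∀ k, a c (k + 1) = ∑ j ∈ Finset.Icc 1 N, if c (j + 1) < c j then
        a (Function.update c j (c j - 1)) k - a c k else 0 := by
      intro k
      simp only [a, constraintIter]
      rw [integral_finsetSum]
      · refine Finset.sum_congr rfl fun j _ => ?_
        split_ifs
        · exact integral_sub (hint _ _) (hint _ _)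
        · simp
      · intro j _
        split_ifs
        · exact (hint _ _).sub (hint _ _)
        · exact integrable_zero _ _ _
    simp_rw [ha1, Finset.mul_sum]
    rw [Summable.tsum_finsetSum]
    · refine Finset.sum_congr rfl fun j _ => ?_
      split_ifs
      · simp_rw [mul_sub]
        exact (summable_expSeries (ha _) τ).tsum_sub (summable_expSeries (ha _) τ)
      · simp
    · intro j _
      split_ifs
      · simp_rw [mul_sub]
        exact (summable_expSeries (ha _) τ).sub (summable_expSeries (ha _) τ)
      · simp
  have hFp : ∀ c, IsConstraint N c → ∀ τ : ℝ≥0,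
      μ.real (A ∩ constraintSet X N (s + τ) c) = F c τ := fun c hc τ =>
    hX.measureReal_inter_constraintSet_add s τ hc hA
  let D : (ℕ → ℕ) → ℝ → ℂ := fun c τ =>
    chainDet r R (fun i => (n i : ℕ)) (fun i => (t i : ℝ)) N (s + τ) (Sum.elim d c)
  have hD : ∀ c, IsConstraint N c → ∀ τ, HasDerivAt (D c)
      (∑ j ∈ Finset.Icc 1 N, if c (j + 1) < c j then
        D (Function.update c j (c j - 1)) τ - D c τ else 0) τ := by
    intro c hc τ
    have h1 := (hasDerivAt_chainDet (n := fun i => (n i : ℕ)) (t := fun i => (t i : ℝ)) (N := N)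
      (T := s + τ) hr hr1 hR hR1 (c := Sum.elim d c)
      (fun j hj _ => by simpa using hc.2 j hj)).comp_const_add (s : ℝ) τ
    refine h1.congr_deriv (Finset.sum_congr rfl fun j hj => ?_)
    simp only [Sum.elim_inr, Sum.update_elim_inr]
    split_ifs with hlt
    · rfl
    · rw [Finset.mem_Icc] at hj
      rw [sub_eq_zero]
      rcases Nat.eq_zero_or_pos (c j) with h0 | h0
      · rw [h0, Nat.zero_sub]
        nth_rw 1 [← h0]
        rw [Function.update_eq_self]
      -- On a plateau the determinant is unaffected by lowering, so the term that the generator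
      -- omits is zero here as well.
      · have hjN : j + 1 ≤ N := by
          by_contra hjN
          have := hc.1 (j + 1) (by omega)
          omega
        have h2 := chainDet_update_succ_of_le (R := R) (n := fun i => (n i : ℕ))
          (t := fun i => (t i : ℝ)) (T := s + τ) hr hr1 (c := Sum.elim d c) (v := c j - 1)
          hj.1 hjN (by simp only [Sum.elim_inr]; omega)
        rwa [Nat.sub_add_cancel h0, Sum.update_elim_inr, Sum.update_elim_inr,
          Function.update_eq_self] at h2
  have hzero := eq_zero_of_hasDerivAt_lowering N
    (P := fun c => IsConstraint N c ∧ ∀ j, ν < j → c j = 0)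
    (H := fun c τ => (F c τ : ℂ) - D c τ) ?_ ?_ ?_ c ⟨hc, hcν⟩ τ
  · rw [sub_eq_zero] at hzero
    unfold HasChainDet
    rw [hFp c hc τ, hzero]
    simp only [D, NNReal.coe_add]
  · rintro c ⟨hc, hcν⟩ j _ hlt
    refine ⟨hc.update hlt, fun i hi => ?_⟩
    by_cases hij : i = j
    · subst hij; simp [hcν i hi]
    · simpa [hij] using hcν i hi
  · rintro c ⟨hc, hcν⟩
    have h0 := h c hcν hc
    unfold HasChainDet at h0
    have h1 := hFp c hc 0
    rw [add_zero] at h1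
    rw [sub_eq_zero, ← NNReal.coe_zero, ← h1, h0]
    simp [D]
  · rintro c ⟨hc, hcν⟩ τ
    refine ((hF c τ).ofReal_comp.sub (hD c hc τ)).congr_deriv ?_
    push_cast
    rw [← Finset.sum_sub_distrib]
    refine Finset.sum_congr rfl fun j _ => ?_
    split_ifs
    · push_cast; ring
    · simp

/-- All shifted positions are `0` at the start, so any positive constraint fails. On the determinant
side a vanishing column is found at the largest constrained label. -/
theorem hasChainDet_zero [IsProbabilityMeasure μ] (hX : IsStepTASEP μ X) (hr : 0 < r) (hR : 0 < R)
    {d : Fin m → ℕ} (hd : ∀ i, d i = 0) {c : ℕ → ℕ} :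
    HasChainDet μ X r R n t N 0 d c := by
  unfold HasChainDet
  by_cases h0 : ∀ j, 1 ≤ j → j ≤ N → c j = 0
  · rw [NNReal.coe_zero, chainDet_eq_one (by simpa using hd) (by simpa using h0)]
    have : μ.real (pastSet X n t d ∩ constraintSet X N 0 c) = μ.real Set.univ := by
      refine measureReal_congr ?_
      filter_upwards [hX.initial] with ω hω
      refine propext ⟨fun _ => trivial, fun _ => ⟨fun i hi => ?_, fun j hj => ?_⟩⟩
      · exact absurd (hd i) hi.ne'
      · rw [h0 j j.pos hj, hω j]
        simp
    rw [this, probReal_univ, Complex.ofReal_one]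
  · push Not at h0
    have hne : ((Finset.Icc 1 N).filter fun j => c j ≠ 0).Nonempty := by
      obtain ⟨j, hj1, hjN, hj⟩ := h0
      exact ⟨j, by simp [hj1, hjN, hj]⟩
    have hmem := Finset.max'_mem _ hne
    set j := Finset.max' _ hne with hj
    simp only [Finset.mem_filter, Finset.mem_Icc] at hmem
    rw [NNReal.coe_zero, chainDet_zero_eq_zero hr hR (j := j) (by simpa using hd) hmem.1.1 hmem.1.2
      (by simpa [Nat.pos_iff_ne_zero] using hmem.2)]
    · have : μ.real (pastSet X n t d ∩ constraintSet X N 0 c) = μ.real ∅ := by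
        refine measureReal_congr ?_
        filter_upwards [hX.initial] with ω hω
        refine propext ⟨fun H => ?_, False.elim⟩
        have h1 := H.2 (⟨j, hmem.1.1⟩ : ℕ+) hmem.1.2
        have h2 := hω (⟨j, hmem.1.1⟩ : ℕ+)
        rw [h2, neg_add_cancel] at h1
        have h3 : c j ≤ 0 := by exact_mod_cast h1
        exact absurd h3 (by omega)
      rw [this, measureReal_empty, Complex.ofReal_zero]
    · intro i hi hiN
      by_contra hci
      have := Finset.le_max' _ i (show i ∈ (Finset.Icc 1 N).filter fun j => c j ≠ 0 by
        simp only [Finset.mem_filter, Finset.mem_Icc]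
        exact ⟨⟨by omega, hiN⟩, by simpa using hci⟩)
      omega

/-- At `T = t k` the past and the current constraint on label `n k` concern the same random
variable, so together they are the constraint by the maximum. `chainDet_transfer` gives the same for
determinants. -/
theorem hasChainDet_of_transfer (hr : 0 < r) {k : Fin m} (hkN : (n k : ℕ) ≤ N)
    {d : Fin m → ℕ} (hd : ∀ i, k < i → d i = 0) {c : ℕ → ℕ} (hc : ∀ j, (n k : ℕ) < j → c j = 0)
    (h : HasChainDet μ X r R n t N (t k) (Function.update d k 0)
      (Function.update c (n k) (max (c (n k)) (d k)))) :
    HasChainDet μ X r R n t N (t k) d c := by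
  unfold HasChainDet at h ⊢
  rw [chainDet_transfer hr (k := k) rfl (n k).pos hkN (by simpa using hd) (by simpa using hc)]
  simp only [Sum.elim_inr, Sum.elim_inl, Sum.update_elim_inr, Sum.update_elim_inl]
  rw [← h]
  suffices hset : pastSet X n t d ∩ constraintSet X N (t k) c =
      pastSet X n t (Function.update d k 0) ∩ constraintSet X N (t k)
        (Function.update c (n k) (max (c (n k)) (d k))) by rw [hset]
  ext ω
  simp only [Set.mem_inter_iff]
  constructor
  · rintro ⟨h1, h2⟩
    refine ⟨fun i hi => ?_, fun j hj => ?_⟩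
    · by_cases hik : i = k
      · subst hik; simp at hi
      · rw [Function.update_of_ne hik] at hi ⊢
        exact h1 i hi
    · by_cases hjk : j = n k
      · subst hjk
        have h3 := h2 _ hj
        have h4 := h1 k
        rw [Function.update_self]
        omega
      · rw [Function.update_of_ne (by simpa using hjk)]
        exact h2 j hj
  · rintro ⟨h1, h2⟩
    have h5 := h2 _ hkN
    rw [Function.update_self] at h5
    refine ⟨fun i hi => ?_, fun j hj => ?_⟩
    · by_cases hik : i = k
      · subst hik
        omega
      · have h3 := h1 i
        rw [Function.update_of_ne hik] at h3
        exact h3 hi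
    · by_cases hjk : j = n k
      · subst hjk
        omega
      · have h3 := h2 j hj
        rwa [Function.update_of_ne (by simpa using hjk)] at h3

/-- The joint distribution of TASEP along a space-like path is a finite determinant. -/
theorem hasChainDet_of_spaceLike [IsProbabilityMeasure μ] (hX : IsStepTASEP μ X) (hr : 0 < r)
    (hr1 : r < 1) (hR : 0 < R) (hR1 : R < 1) (hn : ∀ i j, i < j → n j ≤ n i)
    (ht : ∀ i j, i < j → t i ≤ t j) (hN : ∀ i, (n i : ℕ) ≤ N) (k : ℕ) {T : ℝ≥0} {d : Fin m → ℕ}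
    {c : ℕ → ℕ} (hd : ∀ i : Fin m, k ≤ i → d i = 0) (htT : ∀ i : Fin m, (i : ℕ) < k → t i ≤ T)
    (hcn : ∀ i : Fin m, (i : ℕ) < k → ∀ j, (n i : ℕ) < j → c j = 0) (hcN : ∀ j, N < j → c j = 0) :
    HasChainDet μ X r R n t N T d c := by
  induction k generalizing T d c with
  | zero =>
    refine hasChainDet_of_antitone hX hr hr1 le_rfl (fun c' hc' hcc' => ?_) hcN
    have := hasChainDet_add hX hr hr1 hR hR1 (s := 0) (ν := N) (d := d) (n := n) (t := t)
      (fun i hi => absurd (hd i (Nat.zero_le _)) hi.ne')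
      (fun c _ _ => hasChainDet_zero hX hr hR fun i => hd i (Nat.zero_le _)) T hc' hcc'
    rwa [zero_add] at this
  | succ k ih =>
    by_cases hkm : m ≤ k
    · exact ih (fun i hi => by omega) (fun i hi => htT i (by omega))
        (fun i hi => hcn i (by omega)) hcN
    -- Only the first `k + 1` points can carry constraints; `κ` is the last of them. Time runs back
    -- from `T` to `t κ`, where the constraint of `κ` is transferred.
    set κ : Fin m := ⟨k, not_le.1 hkm⟩ with hκ
    have hlt : ∀ i : Fin m, (i : ℕ) < k → i < κ := fun i hi => hi
    obtain ⟨τ, rfl⟩ := exists_add_of_le (htT κ (Nat.lt_succ_self k))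
    refine hasChainDet_of_antitone hX hr hr1 (hN κ) (fun c' hc' hcc' => ?_)
      (hcn κ (Nat.lt_succ_self k))
    refine hasChainDet_add hX hr hr1 hR hR1 (ν := n κ) (fun i hi => ?_) (fun c hc _ => ?_)
      τ hc' hcc'
    · rcases lt_trichotomy i κ with h | h | h
      · exact ht i κ h
      · rw [h]
      · exact absurd (hd i (Nat.succ_le_of_lt h)) hi.ne'
    · refine hasChainDet_of_transfer hr (hN κ) (fun i hi => hd i (Nat.succ_le_of_lt hi)) hc
        (ih ?_ (fun i hi => ht i κ (hlt i hi)) ?_ ?_)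
      · intro i hi
        by_cases hiκ : i = κ
        · subst hiκ; simp
        · rw [Function.update_of_ne hiκ]
          refine hd i ?_
          have : (i : ℕ) ≠ k := fun h => hiκ (Fin.ext h)
          omega
      · intro i hi j hj
        -- After the transfer the current constraints sit on labels at most `n κ`, hence at most the
        -- label of every earlier point.
        have h1 : (n κ : ℕ) ≤ n i := hn i κ (hlt i hi)
        rw [Function.update_of_ne (by omega)]
        exact hc j (by omega)
      · intro j hj
        have := hN κ
        rw [Function.update_of_ne (by omega)]
        exact hc j (by omega)

end Chain

/-! ### Fredholm series of finite determinants -/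

section Fredholm

/-- Tuples with a repetition give equal rows. The remaining ones are the `k!` orderings of the
`k`-element sets, and simultaneous reordering of rows and columns preserves the determinant. -/
theorem sum_det_submatrix_eq {n : Type*} [Fintype n] [DecidableEq n] (A : Matrix n n ℂ) (k : ℕ) :
    ∑ y : Fin k → n, (A.submatrix y y).det = (k.factorial : ℂ) *
      ∑ s ∈ Finset.univ.powersetCard k,
        (A.submatrix (Subtype.val : s → n) (Subtype.val : s → n)).det := by
  have hinj : ∀ y : Fin k → n, ¬ Function.Injective y → (A.submatrix y y).det = 0 := by
    intro y hy
    simp only [Function.Injective, not_forall] at hy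
    obtain ⟨i, j, hij, hne⟩ := hy
    refine Matrix.det_zero_of_row_eq hne ?_
    ext q
    simp [hij]
  rw [← Finset.sum_fiberwise_of_maps_to (s := Finset.univ) (t := Finset.univ)
    (g := fun y : Fin k → n => Finset.univ.image y) (fun _ _ => Finset.mem_univ _),
    ← Finset.sum_subset (Finset.subset_univ (Finset.univ.powersetCard k)), Finset.mul_sum]
  · refine Finset.sum_congr rfl fun s hs => ?_
    rw [Finset.mem_powersetCard_univ] at hs
    have hcard : Fintype.card (Fin k) = Fintype.card s := by simp [hs]
    have hf : (k.factorial : ℂ) = ∑ _e : Fin k ≃ s, (1 : ℂ) := by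
      rw [Finset.sum_const, Finset.card_univ,
        Fintype.card_equiv (Fintype.equivOfCardEq hcard), Fintype.card_fin, nsmul_one]
    rw [hf, Finset.sum_mul]
    refine (Finset.sum_bij (fun (e : Fin k ≃ s) _ => fun a => (e a : n)) ?_ ?_ ?_ ?_).symm
    · intro e _
      simp only [Finset.mem_filter, Finset.mem_univ, true_and]
      ext x
      simp only [Finset.mem_image, Finset.mem_univ, true_and]
      constructor
      · rintro ⟨a, rfl⟩
        exact (e a).2
      · intro hx
        exact ⟨e.symm ⟨x, hx⟩, by simp⟩
    · intro e _ e' _ h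
      ext a
      exact congrFun h a
    · intro y hy
      simp only [Finset.mem_filter, Finset.mem_univ, true_and] at hy
      have hmem : ∀ a, y a ∈ s := fun a => hy ▸ Finset.mem_image_of_mem y (Finset.mem_univ a)
      have hsurj : Function.Surjective fun a => (⟨y a, hmem a⟩ : s) := by
        rintro ⟨x, hx⟩
        rw [← hy] at hx
        obtain ⟨a, _, rfl⟩ := Finset.mem_image.1 hx
        exact ⟨a, rfl⟩
      exact ⟨Equiv.ofBijective _ ((Fintype.bijective_iff_surjective_and_card _).2 ⟨hsurj, hcard⟩),
        Finset.mem_univ _, rfl⟩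
    · intro e _
      rw [one_mul, ← Matrix.det_submatrix_equiv_self e, Matrix.submatrix_submatrix]
      rfl
  · intro s _ hs
    rw [Finset.mem_powersetCard_univ] at hs
    refine Finset.sum_eq_zero fun y hy => hinj y fun h => hs ?_
    simp only [Finset.mem_filter, Finset.mem_univ, true_and] at hy
    rw [← hy, Finset.card_image_of_injective _ h, Finset.card_univ, Fintype.card_fin]

/-- The coefficients of `det (1 + X A)` are sums of principal minors; evaluation at `X = -1` gives a
series with finitely many nonzero terms. -/
theorem hasSum_det_one_sub {n : Type*} [Fintype n] [DecidableEq n] (A : Matrix n n ℂ) :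
    HasSum (fun k : ℕ => ((-1 : ℂ) ^ k / (k.factorial : ℂ)) *
      ∑ y : Fin k → n, (A.submatrix y y).det) (1 - A).det := by
  set P : Polynomial ℂ :=
    (1 + (Polynomial.X : Polynomial ℂ) • A.map Polynomial.C).det with hP
  have hterm : ∀ k : ℕ, ((-1 : ℂ) ^ k / (k.factorial : ℂ)) *
      ∑ y : Fin k → n, (A.submatrix y y).det = P.coeff k * (-1) ^ k := by
    intro k
    have := Nat.cast_ne_zero (R := ℂ).2 k.factorial_ne_zero
    rw [sum_det_submatrix_eq, hP, Matrix.coeff_det_one_add_X_smul_eq_sum_minors]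
    field_simp
  have heval : (1 - A).det = P.eval (-1) := by
    rw [hP, ← Polynomial.coe_evalRingHom, RingHom.map_det]
    congr 1
    ext i j
    simp [Matrix.one_apply, apply_ite (Polynomial.eval (-1 : ℂ)), sub_eq_add_neg]
  simp_rw [hterm]
  rw [heval, Polynomial.eval_eq_sum_range]
  refine hasSum_sum_of_ne_finset_zero fun k hk => ?_
  rw [Polynomial.coeff_eq_zero_of_natDegree_lt (by simpa [Nat.lt_succ_iff] using hk), zero_mul]

variable {I : Type*}

/-- A kernel whose minors vanish outside a finite window has a Fredholm determinant, which is the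
determinant on the window. -/
theorem hasFredholmDet_of_finite [DecidableEq I] {K : I → I → ℂ} (W : Finset I)
    (hK : ∀ (k : ℕ) (y : Fin k → I), (∃ i, y i ∉ W) →
      (Matrix.of fun i j : Fin k => K (y i) (y j)).det = 0) :
    HasFredholmDet K (minorDet (fun p q => (if p = q then 1 else 0) - K p q) W) := by
  have hz : ∀ (k : ℕ) (y : Fin k → I), y ∉ Fintype.piFinset (fun _ : Fin k => W) →
      (Matrix.of fun i j : Fin k => K (y i) (y j)).det = 0 := fun k y hy =>
    hK k y (by simpa [Fintype.mem_piFinset] using hy)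
  refine ⟨fun k => summable_of_ne_finset_zero (s := Fintype.piFinset fun _ => W) (hz k), ?_⟩
  have hsum : ∀ k : ℕ, ∑' y : Fin k → I, (Matrix.of fun i j : Fin k => K (y i) (y j)).det =
      ∑ y : Fin k → W, ((Matrix.of fun p q : W => K p q).submatrix y y).det := by
    intro k
    rw [tsum_eq_sum (s := Fintype.piFinset fun _ => W) (hz k)]
    refine (Finset.sum_bij (fun (y : Fin k → W) _ => fun a => (y a : I)) ?_ ?_ ?_ ?_).symm
    · intro y _
      simp [Fintype.mem_piFinset]
    · intro y _ y' _ h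
      ext a
      exact congrFun h a
    · intro y hy
      exact ⟨fun a => ⟨y a, Fintype.mem_piFinset.1 hy a⟩, Finset.mem_univ _, rfl⟩
    · intro y _
      rfl
  simp_rw [hsum]
  have hdet : minorDet (fun p q => (if p = q then 1 else 0) - K p q) W =
      (1 - Matrix.of fun p q : W => K p q).det := by
    rw [minorDet]
    congr 1
    ext p q
    simp only [subMatrix, Matrix.of_apply, Matrix.sub_apply, Matrix.one_apply]
    rw [if_congr Subtype.coe_inj rfl rfl]
  rw [hdet]
  exact hasSum_det_one_sub _

theorem minorDet_map {J : Type*} [DecidableEq I] [DecidableEq J] (f : J ↪ I) (M : I → I → ℂ)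
    (W : Finset J) : minorDet M (W.map f) = minorDet (fun p q => M (f p) (f q)) W := by
  let e : W → W.map f := fun x => ⟨f x, Finset.mem_map_of_mem f x.2⟩
  have he : Function.Bijective e := by
    refine ⟨fun x y h => Subtype.ext (f.injective (congrArg Subtype.val h)), fun x => ?_⟩
    obtain ⟨y, hy, hyx⟩ := Finset.mem_map.1 x.2
    exact ⟨⟨y, hy⟩, Subtype.ext hyx⟩
  rw [minorDet, ← Matrix.det_submatrix_equiv_self (Equiv.ofBijective e he)]
  rfl

theorem minorDet_congr [DecidableEq I] {M M' : I → I → ℂ} {W : Finset I}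
    (h : ∀ p ∈ W, ∀ q ∈ W, M p q = M' p q) : minorDet M W = minorDet M' W := by
  rw [minorDet, minorDet]
  congr 1
  ext p q
  exact h p p.2 q q.2

end Fredholm

/-! ### The Fredholm determinant of the TASEP kernel as a finite determinant -/

section Main

variable {m : ℕ} {n : Fin m → ℕ+} {t : Fin m → ℝ≥0} {s : Fin m → ℝ} {r R : ℝ}

theorem spaceLikePrec_iff_lt (hnt : ∀ i j : Fin m, i < j →
    SpaceLikePrec ((n i : ℕ), (t i : ℝ)) ((n j : ℕ), (t j : ℝ))) (i j : Fin m) :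
    SpaceLikePrec ((n i : ℕ), (t i : ℝ)) ((n j : ℕ), (t j : ℝ)) ↔ i < j := by
  refine ⟨fun h => ?_, hnt i j⟩
  rcases lt_trichotomy i j with hij | rfl | hij
  · exact hij
  · exact absurd rfl h.2.2
  · have h' := hnt j i hij
    exact absurd (Prod.ext (le_antisymm h'.1 h.1) (le_antisymm h.2.1 h'.2.1)) h.2.2

/-- The constraint `s k ≤ x` in coordinates shifted by the label. -/
noncomputable def shiftedConstraint (n : Fin m → ℕ+) (s : Fin m → ℝ) (i : Fin m) : ℕ :=
  (⌈s i⌉ + (n i : ℕ)).toNat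

/-- The sites of the window in coordinates shifted by the label, as sites in the original
coordinates. -/
def unshift (n : Fin m → ℕ+) : Fin m × ℤ ↪ Fin m × ℤ where
  toFun p := (p.1, p.2 - (n p.1 : ℕ))
  inj' := by
    rintro ⟨a, u⟩ ⟨b, v⟩ h
    simp only [Prod.mk.injEq] at h
    obtain ⟨rfl, h⟩ := h
    simpa using h

theorem unshift_apply (p : Fin m × ℤ) : unshift n p = (p.1, p.2 - (n p.1 : ℕ)) := rfl

theorem mem_map_unshift {p : Fin m × ℤ} :
    p ∈ (siteWindow Finset.univ (shiftedConstraint n s)).map (unshift n) ↔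
      0 ≤ p.2 + (n p.1 : ℕ) ∧ (p.2 : ℝ) < s p.1 := by
  obtain ⟨a, x⟩ := p
  have key : ∀ u : ℤ, 0 ≤ u → (u < shiftedConstraint n s a ↔ ((u - (n a : ℕ) : ℤ) : ℝ) < s a) := by
    intro u hu
    rw [← Int.lt_ceil, shiftedConstraint]
    omega
  simp only [Finset.mem_map, mem_siteWindow, Finset.mem_univ, true_and]
  constructor
  · rintro ⟨⟨b, u⟩, ⟨h1, h2⟩, h⟩
    simp only [unshift_apply, Prod.mk.injEq] at h
    obtain ⟨rfl, rfl⟩ := h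
    exact ⟨by simpa using h1, (key u h1).1 h2⟩
  · rintro ⟨h1, h2⟩
    refine ⟨(a, x + (n a : ℕ)), ⟨h1, (key _ h1).2 (by simpa using h2)⟩, ?_⟩
    simp [unshift_apply]

open Classical in
theorem tasepKernel_chain_eq (hr : 0 < r) (hR : 0 < R) (hrR : r + R < 1)
    (hnt : ∀ i j : Fin m, i < j →
      SpaceLikePrec ((n i : ℕ), (t i : ℝ)) ((n j : ℕ), (t j : ℝ))) (p q : Fin m × ℤ) :
    tasepKernel r R (n p.1) (t p.1) p.2 (n q.1) (t q.1) q.2 =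
      -((if q.1 < p.1 then kernelPsi r ((n p.1 : ℕ) - (n q.1 : ℕ)) (t p.1 - t q.1)
          ((p.2 + (n p.1 : ℕ)) - (q.2 + (n q.1 : ℕ))) else 0) +
        kernelRank r R (n p.1) (t p.1) (p.2 + (n p.1 : ℕ)) (n q.1) (t q.1)
          (q.2 + (n q.1 : ℕ))) := by
  rw [tasepKernel_eq hr hR hrR]
  simp only [spaceLikePrec_iff_lt hnt]

theorem hasFredholmDet_cutKernel (hr : 0 < r) (hR : 0 < R) (hrR : r + R < 1)
    (hnt : ∀ i j : Fin m, i < j →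
      SpaceLikePrec ((n i : ℕ), (t i : ℝ)) ((n j : ℕ), (t j : ℝ))) (N : ℕ) (T : ℝ) :
    HasFredholmDet
      (cutKernel s fun p q => tasepKernel r R (n p.1) (t p.1) p.2 (n q.1) (t q.1) q.2)
      (chainDet r R (fun i => (n i : ℕ)) (fun i => (t i : ℝ)) N T
        (Sum.elim (shiftedConstraint n s) 0)) := by
  have hr1 : r < 1 := by linarith
  set K : Fin m × ℤ → Fin m × ℤ → ℂ := cutKernel s fun p q =>
    tasepKernel r R (n p.1) (t p.1) p.2 (n q.1) (t q.1) q.2 with hKdef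
  have h := hasFredholmDet_of_finite (K := K)
    ((siteWindow Finset.univ (shiftedConstraint n s)).map (unshift n)) ?_
  · convert h using 1
    let f : Fin m × ℤ ↪ (Fin m ⊕ ℕ) × ℤ :=
      ⟨fun p => (Sum.inl p.1, p.2), fun p q h => by simpa [Prod.ext_iff] using h⟩
    have hf : ∀ p, f p = (Sum.inl p.1, p.2) := fun _ => rfl
    have hW : siteWindow (chainPoints m N) (Sum.elim (shiftedConstraint n s) 0) =
        (siteWindow Finset.univ (shiftedConstraint n s)).map f := by
      ext ⟨a | a, u⟩
      · simp [mem_siteWindow, hf, inl_mem_chainPoints]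
      · simp only [mem_siteWindow, Finset.mem_map, hf]
        simp
    rw [chainDet, hW, minorDet_map, minorDet_map]
    refine minorDet_congr ?_
    intro p hp q hq
    have hp' := mem_map_unshift.1 (Finset.mem_map_of_mem (unshift n) hp)
    have hq' := mem_map_unshift.1 (Finset.mem_map_of_mem (unshift n) hq)
    rw [hKdef, cutKernel, if_pos hp'.2, if_pos hq'.2, tasepKernel_chain_eq hr hR hrR hnt]
    simp only [siteMatrix, one_mul, mul_one, sub_neg_eq_add]
    rw [add_assoc]
    refine congrArg₂ (· + ·) ?_ ?_
    · have : f p = f q ↔ unshift n p = unshift n q :=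
        f.injective.eq_iff.trans (unshift n).injective.eq_iff.symm
      simp only [this]
    · simp only [hf, unshift_apply, Sum.elim_inl, Sum.lex_inl_inl, sub_add_cancel]
  · intro k y hy
    by_cases hs : ∃ i, s (y i).1 ≤ (y i).2
    · obtain ⟨i, hi⟩ := hs
      refine Matrix.det_eq_zero_of_row_eq_zero i fun j => ?_
      simp [hKdef, cutKernel, hi.not_gt]
    · push Not at hs
      have hne : (Finset.univ.filter fun i => (y i).2 + (n (y i).1 : ℕ) < 0).Nonempty := by
        obtain ⟨i, hi⟩ := hy
        refine ⟨i, ?_⟩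
        rw [mem_map_unshift] at hi
        simp only [Finset.mem_filter, Finset.mem_univ, true_and]
        by_contra h0
        exact hi ⟨not_lt.1 h0, hs i⟩
      -- Among the sites with negative shifted position take one whose point is earliest. Its rank
      -- part vanishes, and every strictly earlier point occurring has nonnegative shifted position,
      -- so the ordering terms vanish too and row `i` is zero.
      obtain ⟨i, hi, hmin⟩ := Finset.exists_min_image _ (fun i => (y i).1) hne
      simp only [Finset.mem_filter, Finset.mem_univ, true_and] at hi hmin
      refine Matrix.det_eq_zero_of_row_eq_zero i fun j => ?_
      simp only [Matrix.of_apply, hKdef, cutKernel, tasepKernel_chain_eq hr hR hrR hnt,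
        kernelRank_of_neg hr hr1 _ _ hi]
      split_ifs with h1 h2 h3 <;> try simp
      refine kernelPsi_of_neg hr hr1 _ _ ?_
      by_contra h0
      exact absurd (hmin j (by omega)) (not_le.2 ‹_›)

/-- The Fredholm series of a cut kernel, with the sum over sites written as a sum over points and
sums over half lines. -/
theorem HasFredholmDet.hasSum_cutKernel {K : Fin m × ℤ → Fin m × ℤ → ℂ} {d : ℂ}
    (h : HasFredholmDet (cutKernel s K) d) :
    (∀ (k : ℕ) (l : Fin k → Fin m),
      Summable fun x : (i : Fin k) → {y : ℤ // (y : ℝ) < s (l i)} =>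
        (Matrix.of fun i j : Fin k => K (l i, x i) (l j, x j)).det) ∧
    HasSum
      (fun k : ℕ => ((-1 : ℂ) ^ k / (k.factorial : ℂ)) *
        ∑ l : Fin k → Fin m, ∑' x : (i : Fin k) → {y : ℤ // (y : ℝ) < s (l i)},
          (Matrix.of fun i j : Fin k => K (l i, x i) (l j, x j)).det) d := by
  let g : ∀ k : ℕ, (Fin k → Fin m × ℤ) → ℂ := fun k y =>
    (Matrix.of fun i j : Fin k => cutKernel s K (y i) (y j)).det
  let e : ∀ k : ℕ, (Fin k → Fin m) × (Fin k → ℤ) ≃ (Fin k → Fin m × ℤ) := fun k =>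
    (Equiv.arrowProdEquivProdArrow (Fin k) (fun _ => Fin m) (fun _ => ℤ)).symm
  let φ : ∀ (k : ℕ) (l : Fin k → Fin m), ((i : Fin k) → {y : ℤ // (y : ℝ) < s (l i)}) →
      (Fin k → ℤ) := fun k l x i => x i
  have hφ : ∀ k l, Function.Injective (φ k l) := fun k l x x' hx => by
    ext i
    exact congrFun hx i
  have hg : ∀ k l x, g k (e k (l, φ k l x)) =
      (Matrix.of fun i j : Fin k => K (l i, x i) (l j, x j)).det := by
    intro k l x
    refine congrArg Matrix.det ?_
    ext i j
    have h1 := (x i).2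
    have h2 := (x j).2
    simp [cutKernel, e, φ, Equiv.arrowProdEquivProdArrow, h1, h2]
  -- A tuple with a site beyond its cut gives a zero row, so the sum over all integers reduces to
  -- the half lines.
  have hsupp : ∀ k l, Function.support (fun x => g k (e k (l, x))) ⊆ Set.range (φ k l) := by
    intro k l x hx
    by_contra hx'
    have : ∃ i, ¬ (x i : ℝ) < s (l i) := by
      by_contra hall
      push Not at hall
      exact hx' ⟨fun i => ⟨x i, hall i⟩, rfl⟩
    obtain ⟨i, hi⟩ := this
    refine hx (Matrix.det_eq_zero_of_row_eq_zero i fun j => ?_)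
    simp [cutKernel, e, Equiv.arrowProdEquivProdArrow, hi]
  have hs1 : ∀ k, Summable fun p => g k (e k p) := fun k => (e k).summable_iff.2 (h.1 k)
  have hs2 : ∀ k l, Summable fun x => g k (e k (l, x)) := fun k l => (hs1 k).prod_factor l
  refine ⟨fun k l => ?_, ?_⟩
  · simp_rw [← hg]
    exact (hs2 k l).comp_injective (hφ k l)
  · convert h.2 using 3 with k
    simp_rw [← hg]
    have h1 : ∀ l, ∑' x, g k (e k (l, φ k l x)) = ∑' x, g k (e k (l, x)) := fun l =>
      (hφ k l).tsum_eq (hsupp k l)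
    simp_rw [h1]
    rw [← tsum_fintype (L := SummationFilter.unconditional _), ← (hs1 k).tsum_prod]
    exact (e k).tsum_eq (g k)

end Main

theorem mainTheorem5 {Ω : Type*} [MeasurableSpace Ω] (μ : Measure Ω) [IsProbabilityMeasure μ]
    (X : ℝ≥0 → Ω → (ℕ+ → ℤ)) (hX : IsStepTASEP μ X)
    (m : ℕ) (n : Fin m → ℕ+) (t : Fin m → ℝ≥0) (s : Fin m → ℝ)
    (hnt : ∀ i j : Fin m, i < j →
      SpaceLikePrec ((n i : ℕ), (t i : ℝ)) ((n j : ℕ), (t j : ℝ)))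
    (r R : ℝ) (hr : 0 < r) (hR : 0 < R) (hrR : r + R < 1) :
    HasFredholmDet
      (cutKernel s fun p q => tasepKernel r R (n p.1) (t p.1) p.2 (n q.1) (t q.1) q.2)
      ((μ.real {ω | ∀ k : Fin m, s k ≤ (X (t k) ω (n k) : ℝ)} : ℝ) : ℂ) ∧
    (∀ (k : ℕ) (l : Fin k → Fin m),
      Summable fun x : (i : Fin k) → {y : ℤ // (y : ℝ) < s (l i)} =>
        (Matrix.of fun i j : Fin k =>
          tasepKernel r R (n (l i)) (t (l i)) (x i) (n (l j)) (t (l j)) (x j)).det) ∧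
    HasSum
      (fun k : ℕ => ((-1 : ℂ) ^ k / (k.factorial : ℂ)) *
        ∑ l : Fin k → Fin m, ∑' x : (i : Fin k) → {y : ℤ // (y : ℝ) < s (l i)},
          (Matrix.of fun i j : Fin k =>
            tasepKernel r R (n (l i)) (t (l i)) (x i) (n (l j)) (t (l j)) (x j)).det)
      ((μ.real {ω | ∀ k : Fin m, s k ≤ (X (t k) ω (n k) : ℝ)} : ℝ) : ℂ) := by
  have hN : ∀ i, (n i : ℕ) ≤ ∑ i, (n i : ℕ) := fun i =>
    Finset.single_le_sum (f := fun i => (n i : ℕ)) (fun _ _ => Nat.zero_le _) (Finset.mem_univ i)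
  have htT : ∀ i, t i ≤ ∑ i, t i := fun i =>
    Finset.single_le_sum (f := t) (fun _ _ => zero_le) (Finset.mem_univ i)
  -- The current point carries no constraint, so any label bound and any final time dominating the
  -- given ones will do; the sums are convenient choices.
  have hdet : HasChainDet μ X r R n t (∑ i, (n i : ℕ)) (∑ i, t i) (shiftedConstraint n s) 0 :=
    hasChainDet_of_spaceLike hX hr (by linarith) hR (by linarith)
      (fun i j hij => (hnt i j hij).1) (fun i j hij => (hnt i j hij).2.1) hN m
      (fun i hi => absurd i.2 (not_lt.2 hi)) (fun i _ => htT i) (fun _ _ _ _ => rfl)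
      (fun _ _ => rfl)
  have hprob : μ.real {ω | ∀ k : Fin m, s k ≤ (X (t k) ω (n k) : ℝ)} =
      μ.real (pastSet X n t (shiftedConstraint n s) ∩
        constraintSet X (∑ i, (n i : ℕ)) (∑ i, t i) 0) := by
    refine measureReal_congr ?_
    filter_upwards [ae_all_iff.2 fun i => hX.ae_mem_stepStates (t i),
      hX.ae_mem_stepStates (∑ i, t i)] with ω h1 h2
    have key : ∀ i, s i ≤ (X (t i) ω (n i) : ℝ) ↔
        (shiftedConstraint n s i : ℤ) ≤ X (t i) ω (n i) + (n i : ℕ) := by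
      intro i
      have := (h1 i).2 (n i)
      rw [← Int.ceil_le, shiftedConstraint]
      omega
    refine propext ⟨fun H => ⟨fun i _ => (key i).1 (H i), fun j _ => ?_⟩, fun H i => (key i).2 ?_⟩
    · have := h2.2 j
      simp only [Pi.zero_apply, Nat.cast_zero]
      omega
    · have h3 := H.1 i
      have h4 := (h1 i).2 (n i)
      rcases Nat.eq_zero_or_pos (shiftedConstraint n s i) with h0 | h0
      · rw [h0]
        push_cast
        omega
      · exact h3 h0
  have hF := hasFredholmDet_cutKernel (s := s) hr hR hrR hnt (∑ i, (n i : ℕ)) (∑ i, t i : ℝ≥0)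
  rw [hprob, hdet]
  exact ⟨hF, hF.hasSum_cutKernel.1, hF.hasSum_cutKernel.2⟩
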